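/- **Theorem 2.1 (Convergence for equidistributing meshes).** Let $\Omega=(0,1)$, let $a,b\in W^{1,\infty}(\Omega)$ and $c\in L^\infty(\Omega)$ satisfy $a\ge a_0>0$ and $c-\tfrac12 b'\ge 0$ a.e. in $\Omega$, for a constant $a_0$, and let $f\in L^2(\Omega)$. Put $B(u,v)=\int_\Omega (a u'v'+b u'v+cuv)\,dx$ and $(f,v)=\int_\Omega fv\,dx$, and let $u\in H^1_0(\Omega)$ be the weak solution of $-(au')'+bu'+cu=f$, $u(0)=u(1)=0$, that is, $B(u,v)=(f,v)$ for all $v\in H_0^1(\Omega)$. Let $r=f+a'u'-bu'-cu$. For a mesh $0=x_0<x_1<\dots<x_N=1$ with $h_i=x_i-x_{i-1}$, let $V_h$ be the span of the continuous piecewise linear (hat) basis functions of the interior nodes $x_1,\dots,x_{N-1}$, let $u_h\in V_h$ be the linear finite element solution, $B(u_h,v_h)=(f,v_h)$ for all $v_h\in V_h$, and put $$r_h=f+a'u_h'-bu_h'-cu_h,\qquad \langle r_h\rangle_i=\Big(\frac1{h_i}\int_{x_{i-1}}^{x_i}|r_h|^2dx\Big)^{1/2},$$ $$\alpha_h=\Big[\sum_{i=1}^N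 h_i\langle r_h\rangle_i^{2/3}\Big]^3,\qquad \rho_i=\Big(1+\frac{\langle r_h\rangle_i^2}{\alpha_h}\Big)^{1/3},\qquad \sigma_h=\sum_{i=1}^N\rho_ih_i$$ (with $\rho_i=1$ if $\alpha_h=0$). The mesh is called equidistributing if $\rho_ih_i=\sigma_h/N$ for $i=1,\dots,N$. Write $\|v\|_{L^p(\Omega)}=\big(\int_\Omega|v|^p\,dx\big)^{1/p}$ for all $p>0$. There are positive constants $C$ and $c_0$, depending only on the coefficients $a,b,c$ (not on $f$, $u$, $N$ or the mesh), such that the following hold. 1. For every $N$ and every equidistributing mesh with $N$ cells, $$\|(u-u_h)'\|_{L^2(\Omega)}\le \frac{C\sqrt{\alpha_h}}{N}.$$ 2. $\sqrt{\alpha_h}\to\|r\|_{L^{2/3}(\Omega)}$ as $N\to\infty$ along equidistributing meshes: for every $\varepsilon>0$ there is $N_0$ such that $\big|\sqrt{\alpha_h}-\|r\|_{L^{2/3}(\Omega)}\big|<\varepsilon$ for every equidistributing mesh with $N\ge N_0$ cells. 3. If in addition $r$ has a weak derivative $r'\in L^1(\Omega)$, then for every $N>c_0$ and every equidistributing mesh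 with $N$ cells, $$\Big(1+\big(\tfrac{c_0}{N}\big)^{2/3}\Big)^{-3/2}\|r\|_{L^{2/3}(\Omega)}\le\sqrt{\alpha_h}\le\Big(1-\big(\tfrac{c_0}{N}\big)^{2/3}\Big)^{-3/2}\Big[\|r\|_{L^{2/3}(\Omega)}^{2/3}+\Big(\frac{c_0\|r'\|_{L^1(\Omega)}}{N}\Big)^{2/3}\Big]^{3/2}.$$ -/

import Mathlib

open MeasureTheory Filter Topology
open scoped ContDiff

noncomputable section

namespace EquiFEM

/-- The domain `Ω = (0,1)`. -/
def Omega : Set ℝ := Set.Ioo 0 1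

/-- Lebesgue measure on `Ω`. -/
def muOmega : Measure ℝ := volume.restrict Omega

/-- Test functions on `Ω`: smooth, with compact support inside `Ω`. -/
structure IsTest (φ : ℝ → ℝ) : Prop where
  smooth : ContDiff ℝ ∞ φ
  compact : HasCompactSupport φ
  support : tsupport φ ⊆ Omega

/-- `g'` is a weak (distributional) derivative of `g` on `Ω`. -/
structure HasWeakDeriv (g g' : ℝ → ℝ) : Prop where
  locInt : LocallyIntegrableOn g Omega
  locInt_deriv : LocallyIntegrableOn g' Omega
  parts : ∀ φ : ℝ → ℝ, IsTest φ →
    ∫ x in Omega, g x * deriv φ x = - ∫ x in Omega, g' x * φ x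

/-- `g ∈ W^{1,∞}(Ω)`, with weak derivative `g'`. -/
structure MemW1Inf (g g' : ℝ → ℝ) : Prop where
  weak : HasWeakDeriv g g'
  memLp : MemLp g ⊤ muOmega
  memLp_deriv : MemLp g' ⊤ muOmega

/-- `v ∈ H¹(Ω)`, with weak derivative `v'`. -/
structure MemH1 (v v' : ℝ → ℝ) : Prop where
  weak : HasWeakDeriv v v'
  memLp : MemLp v 2 muOmega
  memLp_deriv : MemLp v' 2 muOmega

/-- `v ∈ H¹₀(Ω)`, with weak derivative `v'`: `v` lies in the closure in `H¹(Ω)` of the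
test functions. -/
structure MemH10 (v v' : ℝ → ℝ) : Prop where
  memH1 : MemH1 v v'
  approx : ∃ φ : ℕ → ℝ → ℝ, (∀ n, IsTest (φ n)) ∧
    Tendsto (fun n => eLpNorm (fun x => φ n x - v x) 2 muOmega) atTop (𝓝 0) ∧
    Tendsto (fun n => eLpNorm (fun x => deriv (φ n) x - v' x) 2 muOmega) atTop (𝓝 0)

/-- `‖v‖_{L^p(Ω)} = (∫_Ω |v|^p)^{1/p}` for real `p > 0` (including `p < 1`). -/
def normLp (p : ℝ) (v : ℝ → ℝ) : ℝ := (∫ x in Omega, |v x| ^ p) ^ (1 / p)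

/-- Standing assumptions on the coefficients of `-(a u')' + b u' + c u = f`;
`a'` and `b'` are weak derivatives of `a` and `b`. -/
structure IsElliptic (a a' b b' c : ℝ → ℝ) (a₀ : ℝ) : Prop where
  memA : MemW1Inf a a'
  memB : MemW1Inf b b'
  memC : MemLp c ⊤ muOmega
  pos : 0 < a₀
  lower : ∀ᵐ x ∂muOmega, a₀ ≤ a x
  nonneg : ∀ᵐ x ∂muOmega, 0 ≤ c x - b' x / 2

/-- `B(u,v) = ∫_Ω (a u' v' + b u' v + c u v)`; `u'` and `v'` are passed explicitly. -/
def bform (a b c u u' v v' : ℝ → ℝ) : ℝ :=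
  ∫ x in Omega, (a x * u' x * v' x + b x * u' x * v x + c x * u x * v x)

/-- `(f,v) = ∫_Ω f v`. -/
def load (f v : ℝ → ℝ) : ℝ := ∫ x in Omega, f x * v x

/-- `u ∈ H¹₀(Ω)`, with weak derivative `u'`, solves the variational problem. -/
structure IsWeakSol (a b c f u u' : ℝ → ℝ) : Prop where
  mem : MemH10 u u'
  eqn : ∀ v v' : ℝ → ℝ, MemH10 v v' → bform a b c u u' v v' = load f v

/-- A mesh `0 = x_0 < x_1 < ⋯ < x_N = 1` (values of `x` at indices above `N` play no role). -/
structure Mesh (N : ℕ) where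
  x : ℕ → ℝ
  x_zero : x 0 = 0
  x_last : x N = 1
  x_lt : ∀ i < N, x i < x (i + 1)

namespace Mesh

variable {N : ℕ} (m : Mesh N)

/-- Length of the cell `(x_i, x_{i+1})`; the `N` cells are numbered `0, …, N - 1`. -/
def h (i : ℕ) : ℝ := m.x (i + 1) - m.x i

/-- The piecewise linear basis function of the interior node `x_{i+1}`, `i + 1 < N`: it is `1` at
`x_{i+1}`, `0` outside `(x_i, x_{i+2})`, and linear on the two cells between. -/
def hat (i : ℕ) (t : ℝ) : ℝ :=
  max 0 (min ((t - m.x i) / m.h i) ((m.x (i + 2) - t) / m.h (i + 1)))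

/-- The linear finite element space spanned by the basis functions of the `N - 1`
interior nodes. -/
def feSpace : Submodule ℝ (ℝ → ℝ) :=
  Submodule.span ℝ {φ | ∃ i : ℕ, i + 1 < N ∧ φ = m.hat i}

/-- `u_h` is the linear finite element solution on the mesh. Elements of the space are
differentiable off the mesh points, so `deriv` is their weak derivative. -/
structure IsFESol (a b c f uh : ℝ → ℝ) : Prop where
  mem : uh ∈ m.feSpace
  eqn : ∀ v ∈ m.feSpace, bform a b c uh (deriv uh) v (deriv v) = load f v

/-- `⟨w⟩_i`, the `L²` average of `w` over the `i`-th cell. -/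
def avg (w : ℝ → ℝ) (i : ℕ) : ℝ :=
  Real.sqrt (1 / m.h i * ∫ x in Set.Ioo (m.x i) (m.x (i + 1)), |w x| ^ 2)

/-- `α_h = [Σ_i h_i ⟨w⟩_i^{2/3}]³`, for the residual `w`. -/
def alpha (w : ℝ → ℝ) : ℝ :=
  (∑ i ∈ Finset.range N, m.h i * m.avg w i ^ (2 / 3 : ℝ)) ^ 3

/-- `ρ_i = (1 + ⟨w⟩_i² / α_h)^{1/3}`, for the residual `w`
(equal to `1` in the degenerate case `α_h = 0`, in which all the `⟨w⟩_i` vanish). -/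
def rho (w : ℝ → ℝ) (i : ℕ) : ℝ :=
  (1 + m.avg w i ^ 2 / m.alpha w) ^ (1 / 3 : ℝ)

/-- `σ_h = Σ_i ρ_i h_i`. -/
def sigma (w : ℝ → ℝ) : ℝ := ∑ i ∈ Finset.range N, m.rho w i * m.h i

/-- The equidistribution principle `ρ_i h_i = σ_h / N` on all cells. -/
def Equidistributes (w : ℝ → ℝ) : Prop :=
  ∀ i < N, m.rho w i * m.h i = m.sigma w / N

end Mesh

/-- The residual `f + a' v' - b v' - c v`. -/
def residual (a' b c f v v' : ℝ → ℝ) (x : ℝ) : ℝ :=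
  f x + a' x * v' x - b x * v' x - c x * v x

/-- `uh` is the finite element solution on the mesh `m`, and `m` equidistributes the adaptation
function that is computed from the residual of this very `uh`. -/
structure IsEquiFESol {N : ℕ} (m : Mesh N) (a a' b c f uh : ℝ → ℝ) : Prop where
  sol : m.IsFESol a b c f uh
  equi : m.Equidistributes (residual a' b c f uh (deriv uh))

end EquiFEM

end

/-! Galerkin orthogonality lets the error `e = u - u_h` be tested against `e` minus its nodal
interpolant, and `u_h` is affine on each cell, so elementwise integration by parts turns `B(e, e)`
into the integral of `r_h` against that difference. With coercivity and a bound of the difference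
on each cell, this gives `a₀ ‖(u - u_h)'‖_{L²} ≤ (Σ h_i³ ⟨r_h⟩_i²)^{1/2}`. Since
`⟨r_h⟩_i² ≤ α_h ρ_i³` and `ρ_i h_i = σ_h / N ≤ 2 / N`, the right-hand side is at most
`3 √α_h / N`, and `‖r - r_h‖_{L²} ≤ K √α_h / N` because `r - r_h` is linear in `e` and `e'`.

For `p ≤ 1` the sum `S(w) = Σ h_i ⟨w⟩_i^p` is subadditive in `w` and lies between `∫ |w|^p` and
`‖w‖_{L²}^p`. At `p = 2 / 3`, where `S(r_h) = α_h^{1/3}`, this makes `|S(r) - S(r_h)|` at most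
`(K / N)^{2/3} S(r_h)`, so everything reduces to comparing `S(r)` with `∫ |r|^{2/3}` on a fine mesh.
-/

namespace EquiFEM

instance : IsProbabilityMeasure muOmega := ⟨by simp [muOmega, Omega]⟩

lemma muOmega_eq_restrict_Ioc : muOmega = volume.restrict (Set.Ioc (0 : ℝ) 1) :=
  Measure.restrict_congr_set Ioo_ae_eq_Ioc

lemma integral_Omega (g : ℝ → ℝ) : ∫ x in Omega, g x = ∫ x in (0 : ℝ)..1, g x := by
  rw [intervalIntegral.integral_of_le zero_le_one, integral_Ioc_eq_integral_Ioo, Omega]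

lemma integrable_iff_intervalIntegrable {g : ℝ → ℝ} :
    Integrable g muOmega ↔ IntervalIntegrable g volume 0 1 := by
  rw [intervalIntegrable_iff_integrableOn_Ioc_of_le zero_le_one, IntegrableOn,
    muOmega_eq_restrict_Ioc]

lemma ae_mem_Omega : ∀ᵐ x ∂muOmega, x ∈ Omega := ae_restrict_mem measurableSet_Ioo

/-- `F` is absolutely continuous on the interval with endpoints `a` and `b`, with derivative `f`
almost everywhere; equivalently, `F` is an indefinite integral of the integrable function `f`. -/
structure IsPrimitive (F f : ℝ → ℝ) (a b : ℝ) : Prop where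
  absolutelyContinuous : AbsolutelyContinuousOnInterval F a b
  ae_hasDerivAt : ∀ᵐ x, x ∈ Set.uIcc a b → HasDerivAt F (f x) x

namespace IsPrimitive

variable {F f G g : ℝ → ℝ} {a b s t : ℝ}

lemma of_absolutelyContinuous (hF : AbsolutelyContinuousOnInterval F a b) :
    IsPrimitive F (deriv F) a b :=
  ⟨hF, hF.ae_differentiableAt.mono fun _ hx hmem => (hx hmem).hasDerivAt⟩

lemma const_add_integral (hf : IntervalIntegrable f volume a b) (k : ℝ) :
    IsPrimitive (fun x => k + ∫ t in a..x, f t) f a b where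
  absolutelyContinuous :=
    (contDiff_const (n := 1)).contDiffOn.absolutelyContinuousOnInterval.fun_add
      (hf.absolutelyContinuousOnInterval_intervalIntegral Set.left_mem_uIcc)
  ae_hasDerivAt := hf.ae_hasDerivAt_integral.mono fun _ hx hmem =>
    (hx hmem a Set.left_mem_uIcc).const_add k

lemma mono (hF : IsPrimitive F f a b) (hst : Set.uIcc s t ⊆ Set.uIcc a b) :
    IsPrimitive F f s t :=
  ⟨hF.absolutelyContinuous.mono hst, hF.ae_hasDerivAt.mono fun _ hx hmem => hx (hst hmem)⟩

lemma sub (hF : IsPrimitive F f a b) (hG : IsPrimitive G g a b) :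
    IsPrimitive (fun x => F x - G x) (fun x => f x - g x) a b where
  absolutelyContinuous := hF.absolutelyContinuous.fun_sub hG.absolutelyContinuous
  ae_hasDerivAt := by
    filter_upwards [hF.ae_hasDerivAt, hG.ae_hasDerivAt] with x hFx hGx hmem
    exact (hFx hmem).sub (hGx hmem)

lemma mul (hF : IsPrimitive F f a b) (hG : IsPrimitive G g a b) :
    IsPrimitive (fun x => F x * G x) (fun x => f x * G x + F x * g x) a b where
  absolutelyContinuous := hF.absolutelyContinuous.fun_mul hG.absolutelyContinuous
  ae_hasDerivAt := by
    filter_upwards [hF.ae_hasDerivAt, hG.ae_hasDerivAt] with x hFx hGx hmem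
    exact (hFx hmem).mul (hGx hmem)

lemma continuousOn (hF : IsPrimitive F f a b) : ContinuousOn F (Set.uIcc a b) :=
  hF.absolutelyContinuous.continuousOn

lemma ae_deriv_eq (hF : IsPrimitive F f a b) : ∀ᵐ x, x ∈ Set.uIoc a b → deriv F x = f x :=
  hF.ae_hasDerivAt.mono fun _ hx hmem => (hx (Set.uIoc_subset_uIcc hmem)).deriv

lemma intervalIntegrable (hF : IsPrimitive F f a b) : IntervalIntegrable f volume a b :=
  hF.absolutelyContinuous.intervalIntegrable_deriv.congr_ae
    ((ae_restrict_iff' measurableSet_uIoc).2 hF.ae_deriv_eq)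

lemma integral_eq_sub (hF : IsPrimitive F f a b) : ∫ x in a..b, f x = F b - F a := by
  rw [← hF.absolutelyContinuous.integral_deriv_eq_sub]
  exact (intervalIntegral.integral_congr_ae hF.ae_deriv_eq).symm

lemma abs_sub_le_integral_abs (hF : IsPrimitive F f a b) (hs : s ∈ Set.Icc a b)
    (ht : t ∈ Set.Icc a b) : |F s - F t| ≤ ∫ x in a..b, |f x| := by
  wlog hts : t ≤ s generalizing s t
  · rw [abs_sub_comm]
    exact this ht hs (le_of_not_ge hts)
  have hsub : Set.uIcc t s ⊆ Set.uIcc a b :=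
    Set.uIcc_subset_uIcc (Set.Icc_subset_uIcc ht) (Set.Icc_subset_uIcc hs)
  calc |F s - F t| = |∫ x in t..s, f x| := by rw [(hF.mono hsub).integral_eq_sub]
    _ ≤ ∫ x in t..s, |f x| := intervalIntegral.abs_integral_le_integral_abs hts
    _ ≤ ∫ x in a..b, |f x| := intervalIntegral.integral_mono_interval ht.1 hts hs.2
        (.of_forall fun _ => abs_nonneg _) hF.intervalIntegrable.abs

lemma integral_mul_eq (hF : IsPrimitive F f a b) (hG : IsPrimitive G g a b) :
    ∫ x in a..b, F x * g x = F b * G b - F a * G a - ∫ x in a..b, f x * G x := by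
  have hfG := hF.intervalIntegrable.mul_continuousOn hG.continuousOn
  have hFg := hG.intervalIntegrable.continuousOn_mul hF.continuousOn
  rw [← (hF.mul hG).integral_eq_sub, intervalIntegral.integral_add hfG hFg, add_sub_cancel_left]

end IsPrimitive

lemma uIcc_subset_uIcc_zero_one {s t : ℝ} (hs : s ∈ Set.Icc (0 : ℝ) 1)
    (ht : t ∈ Set.Icc (0 : ℝ) 1) : Set.uIcc s t ⊆ Set.uIcc 0 1 :=
  Set.uIcc_of_le (zero_le_one (α := ℝ)) ▸ Set.uIcc_subset_Icc hs ht

namespace IsTest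

variable {φ ψ : ℝ → ℝ}

lemma add (hφ : IsTest φ) (hψ : IsTest ψ) : IsTest (fun x => φ x + ψ x) :=
  ⟨hφ.smooth.add hψ.smooth, hφ.compact.add hψ.compact,
    (tsupport_add φ ψ).trans (Set.union_subset hφ.support hψ.support)⟩

lemma const_mul (hφ : IsTest φ) (k : ℝ) : IsTest (fun x => k * φ x) :=
  ⟨contDiff_const.mul hφ.smooth, hφ.compact.mul_left, tsupport_mul_subset_right.trans hφ.support⟩

lemma deriv (hφ : IsTest φ) : IsTest (deriv φ) :=
  ⟨(contDiff_infty_iff_deriv.1 hφ.smooth).2, hφ.compact.deriv,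
    tsupport_deriv_subset.trans hφ.support⟩

lemma eq_zero (hφ : IsTest φ) {x : ℝ} (hx : x ∉ Omega) : φ x = 0 :=
  image_eq_zero_of_notMem_tsupport fun hmem => hx (hφ.support hmem)

lemma isPrimitive (hφ : IsTest φ) (a b : ℝ) : IsPrimitive φ (_root_.deriv φ) a b :=
  .of_absolutelyContinuous
    (hφ.smooth.of_le (mod_cast le_top)).contDiffOn.absolutelyContinuousOnInterval

lemma integrable_mul {g : ℝ → ℝ} (hφ : IsTest φ) (hg : LocallyIntegrableOn g Omega) :
    Integrable (fun x => g x * φ x) muOmega := by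
  have hprod : IntegrableOn (fun x => g x * φ x) (tsupport φ) :=
    (hg.integrableOn_compact_subset hφ.support hφ.compact.isCompact).mul_continuousOn
      hφ.smooth.continuous.continuousOn hφ.compact.isCompact
  have hsupp : Function.support (fun x => g x * φ x) ⊆ tsupport φ :=
    (Function.support_mul_subset_right g φ).trans (subset_tsupport φ)
  exact ((integrableOn_iff_integrable_of_support_subset hsupp).1 hprod).integrableOn

lemma integrable (hφ : IsTest φ) : Integrable φ muOmega := by
  simpa only [one_mul] using hφ.integrable_mul (locallyIntegrableOn_const (1 : ℝ))

lemma exists_tsupport_subset_Icc (hφ : IsTest φ) :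
    ∃ α β : ℝ, 0 < α ∧ β < 1 ∧ tsupport φ ⊆ Set.Icc α β := by
  rcases (tsupport φ).eq_empty_or_nonempty with hempty | hne
  · exact ⟨1, 0, one_pos, one_pos, by simp [hempty]⟩
  · obtain ⟨α, hα, hαle⟩ := hφ.compact.isCompact.exists_isLeast hne
    obtain ⟨β, hβ, hβle⟩ := hφ.compact.isCompact.exists_isGreatest hne
    exact ⟨α, β, (hφ.support hα).1, (hφ.support hβ).2, fun x hx => ⟨hαle hx, hβle hx⟩⟩

lemma exists_deriv_eq (hφ : IsTest φ) (hmean : ∫ x, φ x ∂muOmega = 0) :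
    ∃ Φ, IsTest Φ ∧ _root_.deriv Φ = φ := by
  obtain ⟨α, β, hα, hβ, hsupp⟩ := hφ.exists_tsupport_subset_Icc
  have hcont : Continuous φ := hφ.smooth.continuous
  have hzero : ∀ x ∉ Set.Icc α β, φ x = 0 := fun x hx =>
    image_eq_zero_of_notMem_tsupport fun hmem => hx (hsupp hmem)
  have hderiv : _root_.deriv (fun x => ∫ t in (0 : ℝ)..x, φ t) = φ :=
    funext fun x => hcont.deriv_integral φ 0 x
  have hprim : ∀ x ∉ Set.Icc α β, ∫ t in (0 : ℝ)..x, φ t = 0 := by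
    intro x hx
    rcases lt_or_ge x α with hxα | hαx
    · refine intervalIntegral.integral_zero_ae (.of_forall fun t ht => hzero t fun hmem => ?_)
      exact absurd (ht.2.trans_lt (max_lt hα hxα)) hmem.1.not_gt
    · have hβx : β < x := lt_of_not_ge fun h => hx ⟨hαx, h⟩
      have htail : ∫ t in (1 : ℝ)..x, φ t = 0 :=
        intervalIntegral.integral_zero_ae (.of_forall fun t ht => hzero t fun hmem =>
          absurd ((lt_min hβ hβx).trans ht.1) hmem.2.not_gt)
      rw [← intervalIntegral.integral_add_adjacent_intervals
        (hcont.intervalIntegrable 0 1) (hcont.intervalIntegrable 1 x), htail, ← integral_Omega]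
      exact (add_zero _).trans hmean
  have hsub : tsupport (fun x => ∫ t in (0 : ℝ)..x, φ t) ⊆ Set.Icc α β :=
    closure_minimal (Function.support_subset_iff'.2 hprim) isClosed_Icc
  refine ⟨fun x => ∫ t in (0 : ℝ)..x, φ t, ⟨?_, .of_support_subset_isCompact isCompact_Icc
    (Function.support_subset_iff'.2 hprim), hsub.trans (Set.Icc_subset_Ioo hα hβ)⟩, hderiv⟩
  rw [contDiff_infty_iff_deriv, hderiv]
  exact ⟨fun x => (hcont.integral_hasStrictDerivAt 0 x).hasDerivAt.differentiableAt, hφ.smooth⟩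

end IsTest

lemma exists_isTest_integral_eq_one : ∃ ψ, IsTest ψ ∧ ∫ x, ψ x ∂muOmega = 1 := by
  let B : ContDiffBump (1 / 2 : ℝ) := ⟨1 / 8, 1 / 4, by norm_num, by norm_num⟩
  have hsupp : tsupport (B.normed volume) ⊆ Omega := by
    rw [B.tsupport_normed_eq, Real.closedBall_eq_Icc]
    exact Set.Icc_subset_Ioo (by norm_num [B]) (by norm_num [B])
  refine ⟨B.normed volume, ⟨B.contDiff_normed, B.hasCompactSupport_normed, hsupp⟩, ?_⟩
  rw [muOmega, setIntegral_eq_integral_of_forall_compl_eq_zero, B.integral_normed]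
  exact fun x hx => image_eq_zero_of_notMem_tsupport fun hmem => hx (hsupp hmem)

/-- The du Bois-Reymond lemma. -/
lemma ae_eq_const_of_integral_mul_deriv_eq_zero {g : ℝ → ℝ} (hg : LocallyIntegrableOn g Omega)
    (h : ∀ φ, IsTest φ → ∫ x, g x * deriv φ x ∂muOmega = 0) :
    ∃ k : ℝ, ∀ᵐ x ∂muOmega, g x = k := by
  obtain ⟨ψ, hψ, hψ_one⟩ := exists_isTest_integral_eq_one
  set k := ∫ x, g x * ψ x ∂muOmega
  -- `φ - (∫ φ) ψ` has mean zero, so it is the derivative of a test function.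
  have horth : ∀ φ, IsTest φ → ∫ x, (g x - k) * φ x ∂muOmega = 0 := by
    intro φ hφ
    set M := ∫ x, φ x ∂muOmega
    have hmean : ∫ x, (φ x + -M * ψ x) ∂muOmega = 0 := by
      rw [integral_add hφ.integrable (hψ.integrable.const_mul _), integral_const_mul, hψ_one]
      ring
    obtain ⟨Φ, hΦ, hderiv⟩ := (hφ.add (hψ.const_mul (-M))).exists_deriv_eq hmean
    have hzero : ∫ x, (g x * φ x + -M * (g x * ψ x)) ∂muOmega = 0 := by
      rw [← h Φ hΦ, hderiv]
      congr with x
      ring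
    rw [integral_add (hφ.integrable_mul hg) ((hψ.integrable_mul hg).const_mul _),
      integral_const_mul] at hzero
    simp only [sub_mul]
    rw [integral_sub (hφ.integrable_mul hg) (hφ.integrable.const_mul k), integral_const_mul]
    linarith
  have hae := isOpen_Ioo.ae_eq_zero_of_integral_contDiff_smul_eq_zero (μ := volume)
    (hg.sub (locallyIntegrableOn_const k)) fun φ hsmooth hcompact hsupp => by
      have hφ : IsTest φ := ⟨hsmooth, hcompact, hsupp⟩
      rw [← setIntegral_eq_integral_of_forall_compl_eq_zero (s := Omega)
        fun x hx => by simp [hφ.eq_zero hx], ← horth φ hφ]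
      exact integral_congr_ae (.of_forall fun x => mul_comm _ _)
  refine ⟨k, ?_⟩
  filter_upwards [ae_restrict_of_ae hae, ae_mem_Omega] with x hx hmem
  exact sub_eq_zero.1 (hx hmem)

lemma IsPrimitive.locallyIntegrableOn {G g : ℝ → ℝ} (hG : IsPrimitive G g 0 1) :
    LocallyIntegrableOn G Omega :=
  IntegrableOn.locallyIntegrableOn (integrable_iff_intervalIntegrable.2
    hG.continuousOn.intervalIntegrable)

lemma IsPrimitive.integral_mul_deriv {G g φ : ℝ → ℝ} (hG : IsPrimitive G g 0 1)
    (hφ : IsTest φ) : ∫ x in Omega, G x * deriv φ x = - ∫ x in Omega, g x * φ x := by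
  rw [integral_Omega, integral_Omega, hG.integral_mul_eq (hφ.isPrimitive 0 1),
    hφ.eq_zero (x := 0) (by simp [Omega]), hφ.eq_zero (x := 1) (by simp [Omega])]
  ring

lemma IsPrimitive.hasWeakDeriv {G g : ℝ → ℝ} (hG : IsPrimitive G g 0 1) : HasWeakDeriv G g where
  locInt := hG.locallyIntegrableOn
  locInt_deriv :=
    IntegrableOn.locallyIntegrableOn (integrable_iff_intervalIntegrable.2 hG.intervalIntegrable)
  parts _ hφ := hG.integral_mul_deriv hφ

lemma HasWeakDeriv.exists_isPrimitive {g g' : ℝ → ℝ} (hg : HasWeakDeriv g g')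
    (hg' : Integrable g' muOmega) : ∃ G, IsPrimitive G g' 0 1 ∧ g =ᵐ[muOmega] G := by
  have hG (k : ℝ) := IsPrimitive.const_add_integral (integrable_iff_intervalIntegrable.1 hg') k
  obtain ⟨k, hk⟩ := ae_eq_const_of_integral_mul_deriv_eq_zero
    (hg.locInt.sub (hG 0).locallyIntegrableOn) fun φ hφ => by
      simp only [Pi.sub_apply, sub_mul]
      rw [integral_sub (hφ.deriv.integrable_mul hg.locInt)
        (hφ.deriv.integrable_mul (hG 0).locallyIntegrableOn), sub_eq_zero]
      exact (hg.parts φ hφ).trans ((hG 0).integral_mul_deriv hφ).symm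
  refine ⟨_, hG k, ?_⟩
  filter_upwards [hk] with x hx
  simp only [Pi.sub_apply, zero_add] at hx
  linarith

section Poincare

variable {F f : ℝ → ℝ}

lemma IsPrimitive.enorm_le_eLpNorm (hF : IsPrimitive F f 0 1) (hF₀ : F 0 = 0) {p : ENNReal}
    (hp : 1 ≤ p) {x : ℝ} (hx : x ∈ Set.Icc (0 : ℝ) 1) : ‖F x‖ₑ ≤ eLpNorm f p muOmega := by
  have hFx : F x = ∫ t in Set.Ioc 0 x, f t := by
    rw [← intervalIntegral.integral_of_le hx.1, (hF.mono (uIcc_subset_uIcc_zero_one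
      (Set.left_mem_Icc.2 zero_le_one) hx)).integral_eq_sub, hF₀, sub_zero]
  calc ‖F x‖ₑ ≤ ∫⁻ t in Set.Ioc 0 x, ‖f t‖ₑ := hFx ▸ enorm_integral_le_lintegral_enorm _
    _ ≤ eLpNorm f 1 muOmega := by
      rw [eLpNorm_one_eq_lintegral_enorm, muOmega_eq_restrict_Ioc]
      exact lintegral_mono_set (Set.Ioc_subset_Ioc_right hx.2)
    _ ≤ eLpNorm f p muOmega := eLpNorm_le_eLpNorm_of_exponent_le hp
      (integrable_iff_intervalIntegrable.2 hF.intervalIntegrable).aestronglyMeasurable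

lemma IsPrimitive.aestronglyMeasurable (hF : IsPrimitive F f 0 1) :
    AEStronglyMeasurable F muOmega :=
  (integrable_iff_intervalIntegrable.2 hF.continuousOn.intervalIntegrable).aestronglyMeasurable

lemma IsPrimitive.eLpNorm_le_eLpNorm (hF : IsPrimitive F f 0 1) (hF₀ : F 0 = 0) {p q : ENNReal}
    (hq : 1 ≤ q) : eLpNorm F p muOmega ≤ eLpNorm f q muOmega := by
  refine (eLpNorm_le_eLpNorm_of_exponent_le le_top hF.aestronglyMeasurable).trans ?_
  rw [eLpNorm_exponent_top]
  refine eLpNormEssSup_le_of_ae_enorm_bound (ae_mem_Omega.mono fun x hx => ?_)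
  exact hF.enorm_le_eLpNorm hF₀ hq (Set.Ioo_subset_Icc_self hx)

end Poincare

/-- `V` is the continuous representative of a function of `H¹₀(Ω)` with weak derivative `v'`. -/
structure IsH10Rep (V v' : ℝ → ℝ) : Prop where
  isPrimitive : IsPrimitive V v' 0 1
  zero : V 0 = 0
  one : V 1 = 0
  memLp_deriv : MemLp v' 2 muOmega

lemma IsTest.isH10Rep {φ : ℝ → ℝ} (hφ : IsTest φ) : IsH10Rep φ (_root_.deriv φ) where
  isPrimitive := hφ.isPrimitive 0 1
  zero := hφ.eq_zero (by simp [Omega])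
  one := hφ.eq_zero (by simp [Omega])
  memLp_deriv :=
    (hφ.deriv.smooth.continuous.memLp_of_hasCompactSupport hφ.deriv.compact).restrict _

lemma MemH10.exists_isH10Rep {v v' : ℝ → ℝ} (hv : MemH10 v v') :
    ∃ V, IsH10Rep V v' ∧ v =ᵐ[muOmega] V := by
  obtain ⟨φ, hφ, hlim, hlim'⟩ := hv.approx
  have hint : Integrable v' muOmega := hv.memH1.memLp_deriv.integrable one_le_two
  set V : ℝ → ℝ := fun x => 0 + ∫ t in (0 : ℝ)..x, v' t
  have hV : IsPrimitive V v' 0 1 :=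
    .const_add_integral (integrable_iff_intervalIntegrable.1 hint) 0
  have hV₀ : V 0 = 0 := by simp [V]
  have hsub n := (hφ n).isH10Rep.isPrimitive.sub hV
  have hsub₀ n : φ n 0 - V 0 = 0 := by rw [(hφ n).isH10Rep.zero, hV₀, sub_zero]
  have hV₁ : ‖V 1‖ₑ ≤ 0 := ge_of_tendsto' hlim' fun n => by
    simpa [(hφ n).isH10Rep.one] using
      (hsub n).enorm_le_eLpNorm (hsub₀ n) one_le_two (Set.right_mem_Icc.2 zero_le_one)
  have hlimV : Tendsto (fun n => eLpNorm (φ n - V) 2 muOmega) atTop (𝓝 0) :=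
    tendsto_of_tendsto_of_tendsto_of_le_of_le tendsto_const_nhds hlim' (fun _ => zero_le)
      fun n => (hsub n).eLpNorm_le_eLpNorm (hsub₀ n) one_le_two
  have hmeas n : AEStronglyMeasurable (φ n) muOmega :=
    (hφ n).smooth.continuous.aestronglyMeasurable
  refine ⟨V, ⟨hV, hV₀, by simpa using hV₁, hv.memH1.memLp_deriv⟩, ?_⟩
  exact tendstoInMeasure_ae_unique
    (tendstoInMeasure_of_tendsto_eLpNorm two_ne_zero hmeas hv.memH1.memLp.1 hlim)
    (tendstoInMeasure_of_tendsto_eLpNorm two_ne_zero hmeas hV.aestronglyMeasurable hlimV)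

/-- The derivatives of test functions, as a subspace of `L²(Ω)`. Its closure consists of the
functions of mean zero. -/
def testDerivs : Submodule ℝ (Lp ℝ 2 muOmega) where
  carrier := {f | ∃ φ, IsTest φ ∧ f =ᵐ[muOmega] deriv φ}
  add_mem' := by
    rintro f g ⟨φ, hφ, hf⟩ ⟨ψ, hψ, hg⟩
    refine ⟨_, hφ.add hψ, (Lp.coeFn_add f g).trans ((hf.add hg).trans (.of_forall fun x => ?_))⟩
    exact (deriv_fun_add (hφ.smooth.differentiable (by simp) x)
      (hψ.smooth.differentiable (by simp) x)).symm
  zero_mem' :=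
    ⟨fun _ => 0, ⟨contDiff_const, .zero, by simp⟩, (Lp.coeFn_zero ℝ 2 muOmega).trans (by simp; rfl)⟩
  smul_mem' := by
    rintro k f ⟨φ, hφ, hf⟩
    refine ⟨_, hφ.const_mul k, (Lp.coeFn_smul k f).trans ((hf.const_smul k).trans ?_)⟩
    exact .of_forall fun x => (deriv_const_mul_field k).symm

lemma ae_eq_const_of_mem_testDerivs_orthogonal {g : Lp ℝ 2 muOmega} (hg : g ∈ testDerivsᗮ) :
    ∃ k : ℝ, ∀ᵐ x ∂muOmega, g x = k := by
  refine ae_eq_const_of_integral_mul_deriv_eq_zero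
    (IntegrableOn.locallyIntegrableOn ((Lp.memLp g).integrable one_le_two)) fun φ hφ => ?_
  have hφ' := hφ.isH10Rep.memLp_deriv
  rw [← (Submodule.mem_orthogonal _ _).1 hg (hφ'.toLp _) ⟨φ, hφ, hφ'.coeFn_toLp⟩, L2.inner_def]
  refine integral_congr_ae (hφ'.coeFn_toLp.mono fun x hx => ?_)
  simp [hx]

lemma toLp_mem_closure_testDerivs {f : ℝ → ℝ} (hf : MemLp f 2 muOmega)
    (hmean : ∫ x, f x ∂muOmega = 0) : hf.toLp f ∈ testDerivs.topologicalClosure := by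
  rw [← Submodule.orthogonal_orthogonal_eq_closure, Submodule.mem_orthogonal]
  intro g hg
  obtain ⟨k, hk⟩ := ae_eq_const_of_mem_testDerivs_orthogonal hg
  calc inner ℝ g (hf.toLp f) = ∫ x, k * f x ∂muOmega := by
        rw [L2.inner_def]
        refine integral_congr_ae ?_
        filter_upwards [hf.coeFn_toLp, hk] with x hfx hkx
        simp [hfx, hkx, mul_comm]
    _ = 0 := by rw [integral_const_mul, hmean, mul_zero]

lemma exists_isTest_tendsto_eLpNorm_deriv_sub {f : ℝ → ℝ} (hf : MemLp f 2 muOmega)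
    (hmean : ∫ x, f x ∂muOmega = 0) : ∃ φ : ℕ → ℝ → ℝ, (∀ n, IsTest (φ n)) ∧
      Tendsto (fun n => eLpNorm (fun x => deriv (φ n) x - f x) 2 muOmega) atTop (𝓝 0) := by
  obtain ⟨F, hF, hlim⟩ := mem_closure_iff_seq_limit.1 (toLp_mem_closure_testDerivs hf hmean)
  choose φ hφ hFφ using hF
  refine ⟨φ, hφ, ((Lp.tendsto_Lp_iff_tendsto_eLpNorm' _ _).1 hlim).congr fun n => ?_⟩
  exact eLpNorm_congr_ae ((hFφ n).sub hf.coeFn_toLp)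

namespace IsH10Rep

variable {V v' W w' : ℝ → ℝ}

lemma sub (hV : IsH10Rep V v') (hW : IsH10Rep W w') :
    IsH10Rep (fun x => V x - W x) (fun x => v' x - w' x) where
  isPrimitive := hV.isPrimitive.sub hW.isPrimitive
  zero := by rw [hV.zero, hW.zero, sub_zero]
  one := by rw [hV.one, hW.one, sub_zero]
  memLp_deriv := hV.memLp_deriv.sub hW.memLp_deriv

lemma memH1 (hV : IsH10Rep V v') : MemH1 V v' where
  weak := hV.isPrimitive.hasWeakDeriv
  memLp := ⟨hV.isPrimitive.aestronglyMeasurable,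
    (hV.isPrimitive.eLpNorm_le_eLpNorm hV.zero one_le_two).trans_lt hV.memLp_deriv.2⟩
  memLp_deriv := hV.memLp_deriv

lemma memH10 (hV : IsH10Rep V v') : MemH10 V v' := by
  have hmean : ∫ x, v' x ∂muOmega = 0 := by
    rw [muOmega, integral_Omega, hV.isPrimitive.integral_eq_sub, hV.one, hV.zero, sub_zero]
  obtain ⟨φ, hφ, hlim⟩ := exists_isTest_tendsto_eLpNorm_deriv_sub hV.memLp_deriv hmean
  refine ⟨hV.memH1, φ, hφ, ?_, hlim⟩
  refine tendsto_of_tendsto_of_tendsto_of_le_of_le tendsto_const_nhds hlim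
    (fun _ => zero_le) fun n => ?_
  exact ((hφ n).isH10Rep.sub hV).isPrimitive.eLpNorm_le_eLpNorm
    ((hφ n).isH10Rep.sub hV).zero one_le_two

lemma lpNorm_le (hV : IsH10Rep V v') : lpNorm V 2 muOmega ≤ lpNorm v' 2 muOmega := by
  rw [← toReal_eLpNorm hV.isPrimitive.aestronglyMeasurable, ← toReal_eLpNorm hV.memLp_deriv.1]
  exact ENNReal.toReal_mono hV.memLp_deriv.2.ne
    (hV.isPrimitive.eLpNorm_le_eLpNorm hV.zero one_le_two)

end IsH10Rep

lemma lpNorm_two_sq {α : Type*} [MeasurableSpace α] {μ : Measure α} {f : α → ℝ}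
    (hf : AEStronglyMeasurable f μ) : lpNorm f 2 μ ^ 2 = ∫ x, f x ^ 2 ∂μ := by
  have h := lpNorm_eq_integral_norm_rpow_toReal two_ne_zero ENNReal.ofNat_ne_top hf
  rw [h, ← Real.rpow_natCast, ← Real.rpow_mul (integral_nonneg fun x => by positivity)]
  simp

section BilinearForm

variable {a a' b b' c f u u' u₁ u₂ u₁' u₂' v v' v₁ v₂ v₁' v₂' : ℝ → ℝ}

lemma integrable_bform (ha : MemLp a ⊤ muOmega) (hb : MemLp b ⊤ muOmega)
    (hc : MemLp c ⊤ muOmega) (hu : MemH1 u u') (hv : MemH1 v v') :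
    Integrable (fun x => a x * u' x * v' x + b x * u' x * v x + c x * u x * v x) muOmega :=
  (((hu.memLp_deriv.mul' (r := 2) ha).integrable_mul hv.memLp_deriv).add
    ((hu.memLp_deriv.mul' (r := 2) hb).integrable_mul hv.memLp)).add
    ((hu.memLp.mul' (r := 2) hc).integrable_mul hv.memLp)

lemma bform_sub_left (ha : MemLp a ⊤ muOmega) (hb : MemLp b ⊤ muOmega) (hc : MemLp c ⊤ muOmega)
    (hu₁ : MemH1 u₁ u₁') (hu₂ : MemH1 u₂ u₂') (hv : MemH1 v v') :
    bform a b c (fun x => u₁ x - u₂ x) (fun x => u₁' x - u₂' x) v v' =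
      bform a b c u₁ u₁' v v' - bform a b c u₂ u₂' v v' := by
  refine Eq.trans ?_ (integral_sub (integrable_bform ha hb hc hu₁ hv)
    (integrable_bform ha hb hc hu₂ hv))
  exact integral_congr_ae (.of_forall fun x => by ring)

lemma bform_sub_right (ha : MemLp a ⊤ muOmega) (hb : MemLp b ⊤ muOmega) (hc : MemLp c ⊤ muOmega)
    (hu : MemH1 u u') (hv₁ : MemH1 v₁ v₁') (hv₂ : MemH1 v₂ v₂') :
    bform a b c u u' (fun x => v₁ x - v₂ x) (fun x => v₁' x - v₂' x) =
      bform a b c u u' v₁ v₁' - bform a b c u u' v₂ v₂' := by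
  refine Eq.trans ?_ (integral_sub (integrable_bform ha hb hc hu hv₁)
    (integrable_bform ha hb hc hu hv₂))
  exact integral_congr_ae (.of_forall fun x => by ring)

lemma bform_congr_left (h : u₁ =ᵐ[muOmega] u₂) :
    bform a b c u₁ u' v v' = bform a b c u₂ u' v v' :=
  integral_congr_ae (h.mono fun x hx => by simp only [hx])

lemma residual_congr_ae (h : u₁ =ᵐ[muOmega] u₂) :
    residual a' b c f u₁ u' =ᵐ[muOmega] residual a' b c f u₂ u' :=
  h.mono fun x hx => by simp only [residual, hx]

lemma memLp_residual (ha' : MemLp a' ⊤ muOmega) (hb : MemLp b ⊤ muOmega)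
    (hc : MemLp c ⊤ muOmega) (hf : MemLp f 2 muOmega) (hu : MemH1 u u') :
    MemLp (residual a' b c f u u') 2 muOmega :=
  ((hf.add (hu.memLp_deriv.mul' ha')).sub (hu.memLp_deriv.mul' hb)).sub (hu.memLp.mul' hc)

/-- The zeroth-order part of the form is `∫ (c - b' / 2) v²`, because `∫ (b v²)' = 0`. -/
lemma IsElliptic.coercive {a₀ : ℝ} (hcoef : IsElliptic a a' b b' c a₀) (hv : IsH10Rep v v') :
    a₀ * lpNorm v' 2 muOmega ^ 2 ≤ bform a b c v v' v v' := by
  obtain ⟨β, hβ, hbβ⟩ := hcoef.memB.weak.exists_isPrimitive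
    (hcoef.memB.memLp_deriv.integrable le_top)
  have hβv := hβ.mul (hv.isPrimitive.mul hv.isPrimitive)
  have hint := (integrable_iff_intervalIntegrable.2 hβv.intervalIntegrable).const_mul (1 / 2)
  have hform := integrable_bform hcoef.memA.memLp hcoef.memB.memLp hcoef.memC hv.memH1 hv.memH1
  have hzero := hβv.integral_eq_sub
  rw [hv.zero, hv.one, mul_zero, mul_zero, mul_zero, sub_zero, ← integral_Omega] at hzero
  calc a₀ * lpNorm v' 2 muOmega ^ 2 = ∫ x, a₀ * v' x ^ 2 ∂muOmega := by
        rw [lpNorm_two_sq hv.memLp_deriv.1, integral_const_mul]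
    _ ≤ _ := integral_mono_ae (hv.memLp_deriv.integrable_sq.const_mul a₀) (hform.sub hint) ?_
    _ = bform a b c v v' v v' := by
        rw [integral_sub' hform hint, integral_const_mul, muOmega, hzero, mul_zero, sub_zero]
        rfl
  filter_upwards [hbβ, hcoef.lower, hcoef.nonneg] with x hx ha hc
  simp only [Pi.sub_apply, ← hx]
  nlinarith [mul_le_mul_of_nonneg_right ha (sq_nonneg (v' x)), mul_nonneg hc (sq_nonneg (v x))]

lemma IsWeakSol.exists_isH10Rep (hu : IsWeakSol a b c f u u') :
    ∃ U, IsH10Rep U u' ∧ u =ᵐ[muOmega] U ∧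
      ∀ v v', IsH10Rep v v' → bform a b c U u' v v' = load f v := by
  obtain ⟨U, hU, huU⟩ := hu.mem.exists_isH10Rep
  refine ⟨U, hU, huU, fun v v' hv => ?_⟩
  rw [← bform_congr_left huU, hu.eqn v v' hv.memH10]

end BilinearForm

namespace Mesh

variable {N : ℕ} (m : Mesh N) {i j : ℕ} {t : ℝ}

lemma h_pos (hi : i < N) : 0 < m.h i := sub_pos.2 (m.x_lt i hi)

lemma x_mono (hij : i ≤ j) (hj : j ≤ N) : m.x i ≤ m.x j := by
  induction j, hij using Nat.le_induction with
  | base => exact le_rfl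
  | succ k _ ih => exact (ih (by omega)).trans (m.x_lt k (by omega)).le

lemma x_mem_Icc (hi : i ≤ N) : m.x i ∈ Set.Icc (0 : ℝ) 1 :=
  ⟨m.x_zero ▸ m.x_mono i.zero_le hi, m.x_last ▸ m.x_mono hi le_rfl⟩

lemma pos (m : Mesh N) : 0 < N := by
  refine Nat.pos_of_ne_zero fun hN => zero_ne_one (α := ℝ) ?_
  rw [← m.x_zero, ← m.x_last]
  exact congrArg m.x hN.symm

lemma sum_h : ∑ i ∈ Finset.range N, m.h i = 1 := by
  simp only [h, Finset.sum_range_sub, m.x_zero, m.x_last, sub_zero]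

lemma uIcc_subset (hi : i < N) : Set.uIcc (m.x i) (m.x (i + 1)) ⊆ Set.uIcc 0 1 :=
  uIcc_subset_uIcc_zero_one (m.x_mem_Icc hi.le) (m.x_mem_Icc hi)

lemma Icc_subset (hi : i < N) : Set.Icc (m.x i) (m.x (i + 1)) ⊆ Set.Icc 0 1 :=
  Set.Icc_subset_Icc (m.x_mem_Icc hi.le).1 (m.x_mem_Icc hi).2

lemma Ioo_subset (hi : i < N) : Set.Ioo (m.x i) (m.x (i + 1)) ⊆ Omega :=
  Set.Ioo_subset_Ioo (m.x_mem_Icc hi.le).1 (m.x_mem_Icc hi).2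

lemma integral_cell (hi : i < N) (g : ℝ → ℝ) :
    ∫ x in Set.Ioo (m.x i) (m.x (i + 1)), g x = ∫ x in (m.x i)..(m.x (i + 1)), g x := by
  rw [intervalIntegral.integral_of_le (m.x_lt i hi).le, integral_Ioc_eq_integral_Ioo]

lemma sum_integral {g : ℝ → ℝ} (hg : Integrable g muOmega) :
    ∑ i ∈ Finset.range N, ∫ x in Set.Ioo (m.x i) (m.x (i + 1)), g x = ∫ x in Omega, g x := by
  have hadj := intervalIntegral.sum_integral_adjacent_intervals (a := m.x) fun i (hi : i < N) =>
    (integrable_iff_intervalIntegrable.1 hg).mono_set (m.uIcc_subset hi)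
  rw [integral_Omega, ← m.x_zero, ← m.x_last, ← hadj]
  exact Finset.sum_congr rfl fun i hi => m.integral_cell (Finset.mem_range.1 hi) g

lemma hat_of_le (hi : i + 1 < N) (ht : t ≤ m.x i) : m.hat i t = 0 :=
  max_eq_left <| (min_le_left _ _).trans <|
    div_nonpos_of_nonpos_of_nonneg (sub_nonpos.2 ht) (m.h_pos (by omega)).le

lemma hat_of_ge (hi : i + 1 < N) (ht : m.x (i + 2) ≤ t) : m.hat i t = 0 :=
  max_eq_left <| (min_le_right _ _).trans <|
    div_nonpos_of_nonpos_of_nonneg (sub_nonpos.2 ht) (m.h_pos hi).le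

lemma hat_left (hi : i + 1 < N) (ht : t ∈ Set.Icc (m.x i) (m.x (i + 1))) :
    m.hat i t = (t - m.x i) / m.h i := by
  have hle : (t - m.x i) / m.h i ≤ 1 := by
    rw [div_le_one (m.h_pos (by omega)), h]; linarith [ht.2]
  have hge : 1 ≤ (m.x (i + 2) - t) / m.h (i + 1) := by
    rw [one_le_div (m.h_pos hi), h]; linarith [ht.2]
  rw [hat, min_eq_left (hle.trans hge), max_eq_right]
  exact div_nonneg (sub_nonneg.2 ht.1) (m.h_pos (by omega)).le

lemma hat_right (hi : i + 1 < N) (ht : t ∈ Set.Icc (m.x (i + 1)) (m.x (i + 2))) :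
    m.hat i t = (m.x (i + 2) - t) / m.h (i + 1) := by
  have hle : (m.x (i + 2) - t) / m.h (i + 1) ≤ 1 := by
    rw [div_le_one (m.h_pos hi), h]; linarith [ht.1]
  have hge : 1 ≤ (t - m.x i) / m.h i := by
    rw [one_le_div (m.h_pos (by omega)), h]; linarith [ht.1]
  rw [hat, min_eq_right (hle.trans hge), max_eq_right]
  exact div_nonneg (sub_nonneg.2 ht.2) (m.h_pos hi).le

lemma hat_node (hi : i + 1 < N) (hj : j ≤ N) :
    m.hat i (m.x j) = if j = i + 1 then 1 else 0 := by
  split_ifs with hij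
  · rw [hij, m.hat_left hi ⟨(m.x_lt i (by omega)).le, le_rfl⟩]
    exact div_self (m.h_pos (by omega)).ne'
  · rcases Nat.lt_or_gt_of_ne hij with hlt | hgt
    · exact m.hat_of_le hi (m.x_mono (by omega) (by omega))
    · exact m.hat_of_ge hi (m.x_mono (by omega) hj)

lemma exists_lipschitzWith_hat (i : ℕ) : ∃ K, LipschitzWith K (m.hat i) := by
  have hdiv (k : ℝ) : ∃ K, LipschitzWith K fun t : ℝ => t / k :=
    ⟨_, lipschitzWith_iff_norm_sub_le.2 fun s t => by
      rw [← sub_div, norm_div, div_eq_inv_mul, ← norm_inv, ← coe_nnnorm]⟩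
  obtain ⟨K, hK⟩ := hdiv (m.h i)
  obtain ⟨L, hL⟩ := hdiv (m.h (i + 1))
  exact ⟨_, ((hK.comp (LipschitzWith.id.sub (.const (m.x i)))).min
    (hL.comp ((LipschitzWith.const (m.x (i + 2))).sub .id))).const_max 0⟩

lemma hat_affine (hi : i + 1 < N) (hj : j < N) :
    ∃ k s : ℝ, ∀ t ∈ Set.Icc (m.x j) (m.x (j + 1)), m.hat i t = k + s * t := by
  have hfar : j < i ∨ j = i ∨ j = i + 1 ∨ i + 2 ≤ j := by omega
  rcases hfar with hlt | rfl | rfl | hgt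
  · refine ⟨0, 0, fun t ht => ?_⟩
    rw [m.hat_of_le hi (ht.2.trans (m.x_mono hlt (by omega)))]
    ring
  · exact ⟨-m.x j / m.h j, 1 / m.h j, fun t ht => by rw [m.hat_left hi ht]; ring⟩
  · exact ⟨m.x (i + 2) / m.h (i + 1), -1 / m.h (i + 1), fun t ht => by
      rw [m.hat_right hi ht]; ring⟩
  · refine ⟨0, 0, fun t ht => ?_⟩
    rw [m.hat_of_ge hi ((m.x_mono hgt hj.le).trans ht.1)]
    ring

/-- `v` is continuous, affine on every cell, and vanishes at both ends of the interval. Continuity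
is encoded by a global Lipschitz bound, which makes `deriv v` bounded. -/
structure IsPL (v : ℝ → ℝ) : Prop where
  lipschitz : ∃ K, LipschitzWith K v
  zero : v 0 = 0
  one : v 1 = 0
  affine : ∀ i < N, ∃ k s : ℝ, ∀ t ∈ Set.Icc (m.x i) (m.x (i + 1)), v t = k + s * t

lemma isPL_hat (hi : i + 1 < N) : m.IsPL (m.hat i) where
  lipschitz := m.exists_lipschitzWith_hat i
  zero := m.hat_of_le hi (m.x_mem_Icc (by omega)).1
  one := m.hat_of_ge hi (m.x_mem_Icc hi).2
  affine _ hj := m.hat_affine hi hj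

variable {m} {v : ℝ → ℝ}

lemma isPL_of_mem_feSpace (hv : v ∈ m.feSpace) : m.IsPL v := by
  induction hv using Submodule.span_induction with
  | mem v hv =>
    obtain ⟨i, hi, rfl⟩ := hv
    exact m.isPL_hat hi
  | zero => exact ⟨⟨0, .const 0⟩, rfl, rfl, fun i _ => ⟨0, 0, by simp⟩⟩
  | add v w _ _ hv hw =>
    obtain ⟨K, hK⟩ := hv.lipschitz
    obtain ⟨L, hL⟩ := hw.lipschitz
    refine ⟨⟨_, hK.add hL⟩, by simp [hv.zero, hw.zero], by simp [hv.one, hw.one], fun i hi => ?_⟩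
    obtain ⟨k, s, hks⟩ := hv.affine i hi
    obtain ⟨l, r, hlr⟩ := hw.affine i hi
    refine ⟨k + l, s + r, fun t ht => ?_⟩
    rw [Pi.add_apply, hks t ht, hlr t ht]
    ring
  | smul k v _ hv =>
    obtain ⟨K, hK⟩ := hv.lipschitz
    refine ⟨⟨_, (lipschitzWith_smul k).comp hK⟩, by simp [hv.zero], by simp [hv.one],
      fun i hi => ?_⟩
    obtain ⟨l, s, hls⟩ := hv.affine i hi
    refine ⟨k * l, k * s, fun t ht => ?_⟩
    rw [Pi.smul_apply, smul_eq_mul, hls t ht]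
    ring

lemma IsPL.memLp_deriv (hv : m.IsPL v) (p : ENNReal) : MemLp (deriv v) p muOmega := by
  obtain ⟨K, hK⟩ := hv.lipschitz
  exact .of_bound (measurable_deriv v).aestronglyMeasurable K
    (.of_forall fun t => norm_deriv_le_of_lipschitz hK)

lemma IsPL.isH10Rep (hv : m.IsPL v) : IsH10Rep v (deriv v) where
  isPrimitive := by
    obtain ⟨K, hK⟩ := hv.lipschitz
    exact .of_absolutelyContinuous (hK.lipschitzOnWith.absolutelyContinuousOnInterval)
  zero := hv.zero
  one := hv.one
  memLp_deriv := hv.memLp_deriv 2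

lemma IsPL.exists_deriv_eq (hv : m.IsPL v) (hi : i < N) :
    ∃ s : ℝ, ∀ t ∈ Set.Ioo (m.x i) (m.x (i + 1)), deriv v t = s := by
  obtain ⟨k, s, hks⟩ := hv.affine i hi
  refine ⟨s, fun t ht => ?_⟩
  have haff : HasDerivAt (fun t => k + s * t) s t := by
    simpa using ((hasDerivAt_id t).const_mul s).const_add k
  refine (haff.congr_of_eventuallyEq ?_).deriv
  filter_upwards [isOpen_Ioo.mem_nhds ht] with y hy using hks y (Set.Ioo_subset_Icc_self hy)

variable (m) in
/-- The piecewise linear nodal interpolant, for functions vanishing at both ends of the interval. -/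
noncomputable def interpolant (E : ℝ → ℝ) : ℝ → ℝ :=
  ∑ i ∈ Finset.range (N - 1), E (m.x (i + 1)) • m.hat i

lemma interpolant_mem_feSpace (E : ℝ → ℝ) : m.interpolant E ∈ m.feSpace := by
  refine Submodule.sum_mem _ fun i hi => Submodule.smul_mem _ _ (Submodule.subset_span ⟨i, ?_, rfl⟩)
  have := Finset.mem_range.1 hi
  omega

lemma interpolant_node {E : ℝ → ℝ} (hE₀ : E 0 = 0) (hE₁ : E 1 = 0) (hj : j ≤ N) :
    m.interpolant E (m.x j) = E (m.x j) := by
  have hsum : m.interpolant E (m.x j) =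
      ∑ i ∈ Finset.range (N - 1), if j = i + 1 then E (m.x j) else 0 := by
    simp only [interpolant, Finset.sum_apply, Pi.smul_apply, smul_eq_mul]
    refine Finset.sum_congr rfl fun i hi => ?_
    rw [m.hat_node (by have := Finset.mem_range.1 hi; omega) hj]
    split_ifs with hij <;> simp [hij]
  rcases j with _ | k
  · rw [m.x_zero] at hsum ⊢
    simp [hsum, hE₀]
  · rcases hj.eq_or_lt with hN | hN
    · rw [hN, m.x_last, hE₁] at hsum
      simpa [hN, m.x_last, hE₁] using hsum
    · simpa [show k < N - 1 by omega] using hsum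

end Mesh

lemma sq_rpow_half {y p : ℝ} (hy : 0 ≤ y) : (y ^ 2) ^ (p / 2) = y ^ p := by
  rw [← Real.rpow_natCast_mul hy, Nat.cast_ofNat, mul_div_cancel₀ p two_ne_zero]

lemma integrable_abs_rpow {α : Type*} [MeasurableSpace α] {μ : Measure α} [IsFiniteMeasure μ]
    {w : α → ℝ} {p q : ℝ} (hw : MemLp w (ENNReal.ofReal q) μ) (hp : 0 ≤ p) (hpq : p ≤ q) :
    Integrable (fun x => |w x| ^ p) μ := by
  have h := (hw.mono_exponent (ENNReal.ofReal_le_ofReal hpq)).integrable_norm_rpow'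
  rwa [ENNReal.toReal_ofReal hp] at h

namespace Mesh

variable {N : ℕ} (m : Mesh N) {i : ℕ} {v w : ℝ → ℝ} {p : ℝ}

lemma memLp_cell (hi : i < N) {p : ENNReal} (hw : MemLp w p muOmega) :
    MemLp w p (volume.restrict (Set.Ioo (m.x i) (m.x (i + 1)))) :=
  hw.mono_measure (Measure.restrict_mono_set _ (m.Ioo_subset hi))

lemma volume_real_cell (hi : i < N) : volume.real (Set.Ioo (m.x i) (m.x (i + 1))) = m.h i :=
  Real.volume_real_Ioo_of_le (m.x_lt i hi).le

lemma avg_nonneg (w : ℝ → ℝ) (i : ℕ) : 0 ≤ m.avg w i := Real.sqrt_nonneg _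

lemma h_mul_avg_sq (hi : i < N) (w : ℝ → ℝ) :
    m.h i * m.avg w i ^ 2 = ∫ x in Set.Ioo (m.x i) (m.x (i + 1)), |w x| ^ 2 := by
  have hh := m.h_pos hi
  rw [avg, Real.sq_sqrt (mul_nonneg (by positivity) (integral_nonneg fun _ => by positivity))]
  field_simp

lemma sum_h_mul_avg_sq (hw : MemLp w 2 muOmega) :
    ∑ i ∈ Finset.range N, m.h i * m.avg w i ^ 2 = lpNorm w 2 muOmega ^ 2 := by
  rw [lpNorm_two_sq hw.1, muOmega, ← m.sum_integral hw.integrable_sq]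
  refine Finset.sum_congr rfl fun i hi => ?_
  simp only [m.h_mul_avg_sq (Finset.mem_range.1 hi), sq_abs]

lemma sqrt_h_mul_avg (hi : i < N)
    (hw : AEStronglyMeasurable w (volume.restrict (Set.Ioo (m.x i) (m.x (i + 1))))) :
    √(m.h i) * m.avg w i = lpNorm w 2 (volume.restrict (Set.Ioo (m.x i) (m.x (i + 1)))) := by
  rw [← abs_of_nonneg (m.avg_nonneg w i), ← Real.sqrt_sq_eq_abs, ← Real.sqrt_mul (m.h_pos hi).le,
    m.h_mul_avg_sq hi, ← Real.sqrt_sq lpNorm_nonneg, lpNorm_two_sq hw]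
  simp only [sq_abs]

lemma avg_congr (h : v =ᵐ[muOmega] w) (hi : i < N) : m.avg v i = m.avg w i := by
  have hcell : v =ᵐ[volume.restrict (Set.Ioo (m.x i) (m.x (i + 1)))] w :=
    ae_restrict_of_ae_restrict_of_subset (m.Ioo_subset hi) h
  unfold avg
  congr 2
  exact integral_congr_ae (hcell.fun_comp fun y => |y| ^ 2)

lemma avg_add_le (hv : MemLp v 2 muOmega) (hw : MemLp w 2 muOmega) (hi : i < N) :
    m.avg (v + w) i ≤ m.avg v i + m.avg w i := by
  have hv' := m.memLp_cell hi hv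
  have hw' := m.memLp_cell hi hw
  refine le_of_mul_le_mul_left ?_ (Real.sqrt_pos.2 (m.h_pos hi))
  rw [mul_add, m.sqrt_h_mul_avg hi (hv'.add hw').1, m.sqrt_h_mul_avg hi hv'.1,
    m.sqrt_h_mul_avg hi hw'.1]
  exact lpNorm_add_le hv' one_le_two

lemma avg_le_of_abs_le {M : ℝ} (hi : i < N)
    (hw : ∀ x ∈ Set.Ioo (m.x i) (m.x (i + 1)), |w x| ≤ M) : m.avg w i ≤ M := by
  obtain ⟨x₀, hx₀⟩ := Set.nonempty_Ioo.2 (m.x_lt i hi)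
  have hM : 0 ≤ M := (abs_nonneg _).trans (hw x₀ hx₀)
  refine le_of_sq_le_sq (le_of_mul_le_mul_left ?_ (m.h_pos hi)) hM
  calc m.h i * m.avg w i ^ 2 = ∫ x in Set.Ioo (m.x i) (m.x (i + 1)), |w x| ^ 2 :=
        m.h_mul_avg_sq hi w
    _ ≤ ∫ _ in Set.Ioo (m.x i) (m.x (i + 1)), M ^ 2 := by
        refine integral_mono_of_nonneg (.of_forall fun _ => by positivity) (integrable_const _) ?_
        filter_upwards [ae_restrict_mem measurableSet_Ioo] with x hx
        exact pow_le_pow_left₀ (abs_nonneg _) (hw x hx) 2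
    _ = m.h i * M ^ 2 := by rw [setIntegral_const, m.volume_real_cell hi, smul_eq_mul]

lemma integral_rpow_cell_le (hw : MemLp w 2 muOmega) (hi : i < N) (hp₀ : 0 ≤ p) (hp : p ≤ 2) :
    ∫ x in Set.Ioo (m.x i) (m.x (i + 1)), |w x| ^ p ≤ m.h i * m.avg w i ^ p := by
  have hh := m.h_pos hi
  have hvol : volume (Set.Ioo (m.x i) (m.x (i + 1))) ≠ 0 := by
    simpa [Real.volume_Ioo] using m.x_lt i hi
  have hw' := m.memLp_cell hi hw
  have hJensen := (Real.concaveOn_rpow (div_nonneg hp₀ zero_le_two)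
    (div_le_one_of_le₀ hp zero_le_two)).le_map_set_average
    (f := fun x => |w x| ^ 2) (Real.continuous_rpow_const (div_nonneg hp₀ zero_le_two)).continuousOn
    isClosed_Ici hvol measure_Ioo_lt_top.ne (.of_forall fun x => sq_nonneg |w x|)
    hw'.abs.integrable_sq (by
      simp only [Function.comp_def, sq_rpow_half (abs_nonneg _)]
      exact integrable_abs_rpow (q := 2) (by simpa using hw') hp₀ hp)
  simp only [sq_rpow_half (abs_nonneg _), setAverage_eq, m.volume_real_cell hi, ← m.h_mul_avg_sq hi,
    smul_eq_mul, inv_mul_cancel_left₀ hh.ne', sq_rpow_half (m.avg_nonneg w i)] at hJensen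
  exact (inv_mul_le_iff₀ hh).1 hJensen

lemma sum_h_mul_rpow_le {d : ℕ → ℝ} (hd : ∀ i < N, 0 ≤ d i) (hp₀ : 0 ≤ p) (hp : p ≤ 1) :
    ∑ i ∈ Finset.range N, m.h i * d i ^ p ≤ (∑ i ∈ Finset.range N, m.h i * d i) ^ p := by
  simpa only [smul_eq_mul] using (Real.concaveOn_rpow hp₀ hp).le_map_sum
    (fun i hi => (m.h_pos (Finset.mem_range.1 hi)).le) m.sum_h
    (fun i hi => hd i (Finset.mem_range.1 hi))

end Mesh

section ErrorEstimate

variable {N : ℕ} {m : Mesh N} {a a' b b' c f u u' uh E e v W w r : ℝ → ℝ} {a₀ : ℝ}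

namespace Mesh.IsPL

lemma integrable_deriv_mul (hv : m.IsPL v) (hw : Integrable w muOmega) :
    Integrable (fun x => deriv v x * w x) muOmega :=
  memLp_one_iff_integrable.1 ((memLp_one_iff_integrable.2 hw).mul' (hv.memLp_deriv ⊤))

lemma integral_deriv_mul_eq_zero (hv : m.IsPL v) (hW : IsPrimitive W w 0 1)
    (hnode : ∀ i ≤ N, W (m.x i) = 0) : ∫ x in Omega, deriv v x * w x = 0 := by
  have hw : Integrable w muOmega := integrable_iff_intervalIntegrable.2 hW.intervalIntegrable
  rw [← m.sum_integral (hv.integrable_deriv_mul hw)]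
  refine Finset.sum_eq_zero fun i hi => ?_
  have hi := Finset.mem_range.1 hi
  obtain ⟨s, hs⟩ := hv.exists_deriv_eq hi
  calc ∫ x in Set.Ioo (m.x i) (m.x (i + 1)), deriv v x * w x
      = ∫ x in Set.Ioo (m.x i) (m.x (i + 1)), s * w x :=
        setIntegral_congr_fun measurableSet_Ioo fun x hx => by simp only [hs x hx]
    _ = s * (W (m.x (i + 1)) - W (m.x i)) := by
        rw [integral_const_mul, m.integral_cell hi, (hW.mono (m.uIcc_subset hi)).integral_eq_sub]
    _ = 0 := by rw [hnode i hi.le, hnode (i + 1) hi, sub_self, mul_zero]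

lemma abs_sub_le_integral_cell (hv : m.IsPL v) (hE : IsPrimitive E e 0 1)
    (hnode : ∀ i ≤ N, v (m.x i) = E (m.x i)) {i : ℕ} (hi : i < N) {x : ℝ}
    (hx : x ∈ Set.Icc (m.x i) (m.x (i + 1))) :
    |E x - v x| ≤ ∫ t in Set.Ioo (m.x i) (m.x (i + 1)), |e t| := by
  obtain ⟨k, s, hks⟩ := hv.affine i hi
  have hle := (m.x_lt i hi).le
  have hosc {y : ℝ} (hy : y ∈ Set.Icc (m.x i) (m.x (i + 1))) :
      |E x - E y| ≤ ∫ t in Set.Ioo (m.x i) (m.x (i + 1)), |e t| :=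
    m.integral_cell hi _ ▸ (hE.mono (m.uIcc_subset hi)).abs_sub_le_integral_abs hx hy
  obtain ⟨θ, η, hθ, hη, hθη, rfl⟩ : x ∈ segment ℝ (m.x i) (m.x (i + 1)) :=
    segment_eq_Icc hle ▸ hx
  set x := θ • m.x i + η • m.x (i + 1) with hxdef
  have hvx : v x = θ * E (m.x i) + η * E (m.x (i + 1)) := by
    rw [← hnode i hi.le, ← hnode (i + 1) hi, hks x hx, hks _ (Set.left_mem_Icc.2 hle),
      hks _ (Set.right_mem_Icc.2 hle), hxdef, smul_eq_mul, smul_eq_mul]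
    linear_combination -k * hθη
  calc |E x - v x| = |θ * (E x - E (m.x i)) + η * (E x - E (m.x (i + 1)))| := by
        rw [hvx]
        congr 1
        linear_combination -E x * hθη
    _ ≤ θ * |E x - E (m.x i)| + η * |E x - E (m.x (i + 1))| := by
        refine (abs_add_le _ _).trans_eq ?_
        rw [abs_mul, abs_mul, abs_of_nonneg hθ, abs_of_nonneg hη]
    _ ≤ _ := by
        refine (add_le_add
          (mul_le_mul_of_nonneg_left (hosc (Set.left_mem_Icc.2 hle)) hθ)
          (mul_le_mul_of_nonneg_left (hosc (Set.right_mem_Icc.2 hle)) hη)).trans_eq ?_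
        rw [← add_mul, hθη, one_mul]

/-- Elementwise integration by parts: the jumps of `a v'` at the nodes are multiplied by the nodal
values of `W`, which vanish. -/
lemma load_sub_bform_eq (hv : m.IsPL v) (ha : MemW1Inf a a') (hb : MemLp b ⊤ muOmega)
    (hc : MemLp c ⊤ muOmega) (hf : MemLp f 2 muOmega) (hW : IsH10Rep W w)
    (hnode : ∀ i ≤ N, W (m.x i) = 0) :
    load f W - bform a b c v (deriv v) W w =
      ∫ x in Omega, residual a' b c f v (deriv v) x * W x := by
  obtain ⟨A, hA, haA⟩ := ha.weak.exists_isPrimitive (ha.memLp_deriv.integrable le_top)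
  have hAW := hA.mul hW.isPrimitive
  have hzero := hv.integral_deriv_mul_eq_zero hAW fun i hi => by rw [hnode i hi, mul_zero]
  have hload : Integrable (fun x => f x * W x) muOmega := hf.integrable_mul hW.memH1.memLp
  have hform := integrable_bform ha.memLp hb hc hv.isH10Rep.memH1 hW.memH1
  have hres : Integrable (fun x => residual a' b c f v (deriv v) x * W x) muOmega :=
    (memLp_residual ha.memLp_deriv hb hc hf hv.isH10Rep.memH1).integrable_mul hW.memH1.memLp
  have hflux := hv.integrable_deriv_mul
    (integrable_iff_intervalIntegrable.2 hAW.intervalIntegrable)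
  calc load f W - bform a b c v (deriv v) W w
      = ∫ x in Omega, (f x * W x -
          (a x * deriv v x * w x + b x * deriv v x * W x + c x * v x * W x)) :=
        (integral_sub hload hform).symm
    _ = ∫ x in Omega, (residual a' b c f v (deriv v) x * W x -
          deriv v x * (a' x * W x + A x * w x)) := by
        refine integral_congr_ae (haA.mono fun x hx => ?_)
        simp only [hx, residual]
        ring
    _ = ∫ x in Omega, residual a' b c f v (deriv v) x * W x := by
        rw [← muOmega, integral_sub hres hflux, muOmega, hzero, sub_zero]

end Mesh.IsPL

namespace Mesh

lemma integral_cell_mul_le (hr : MemLp r 2 muOmega) (hW : MemLp W 2 muOmega)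
    (he : MemLp e 2 muOmega) {i : ℕ} (hi : i < N) (hbound : ∀ x ∈ Set.Ioo (m.x i) (m.x (i + 1)),
      |W x| ≤ ∫ t in Set.Ioo (m.x i) (m.x (i + 1)), |e t|) :
    ∫ x in Set.Ioo (m.x i) (m.x (i + 1)), r x * W x ≤
      (m.h i * m.avg r i) * (m.h i * m.avg e i) := by
  have hL1 {g : ℝ → ℝ} (hg : MemLp g 2 muOmega) :
      ∫ x in Set.Ioo (m.x i) (m.x (i + 1)), |g x| ≤ m.h i * m.avg g i := by
    simpa only [Real.rpow_one] using
      m.integral_rpow_cell_le (p := 1) hg hi zero_le_one one_le_two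
  have hr' := m.memLp_cell hi hr
  calc ∫ x in Set.Ioo (m.x i) (m.x (i + 1)), r x * W x
      ≤ ∫ x in Set.Ioo (m.x i) (m.x (i + 1)),
          |r x| * ∫ t in Set.Ioo (m.x i) (m.x (i + 1)), |e t| := by
        refine setIntegral_mono_on (hr'.integrable_mul (m.memLp_cell hi hW))
          ((hr'.integrable one_le_two).abs.mul_const _) measurableSet_Ioo fun x hx => ?_
        refine (le_abs_self _).trans ((abs_mul _ _).trans_le ?_)
        exact mul_le_mul_of_nonneg_left (hbound x hx) (abs_nonneg _)
    _ ≤ (m.h i * m.avg r i) * (m.h i * m.avg e i) := by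
        rw [integral_mul_const]
        exact mul_le_mul (hL1 hr) (hL1 he) (integral_nonneg fun _ => abs_nonneg _)
          (mul_nonneg (m.h_pos hi).le (m.avg_nonneg r i))

lemma integral_mul_le (hr : MemLp r 2 muOmega) (hW : MemLp W 2 muOmega)
    (he : MemLp e 2 muOmega) (hbound : ∀ i < N, ∀ x ∈ Set.Ioo (m.x i) (m.x (i + 1)),
      |W x| ≤ ∫ t in Set.Ioo (m.x i) (m.x (i + 1)), |e t|) :
    ∫ x in Omega, r x * W x ≤
      √(∑ i ∈ Finset.range N, m.h i ^ 3 * m.avg r i ^ 2) * lpNorm e 2 muOmega := by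
  have hrW : Integrable (fun x => r x * W x) muOmega := hr.integrable_mul hW
  have hsqrt {i : ℕ} (hi : i ∈ Finset.range N) : √(m.h i) ^ 2 = m.h i :=
    Real.sq_sqrt (m.h_pos (Finset.mem_range.1 hi)).le
  calc ∫ x in Omega, r x * W x
      = ∑ i ∈ Finset.range N, ∫ x in Set.Ioo (m.x i) (m.x (i + 1)), r x * W x :=
        (m.sum_integral hrW).symm
    _ ≤ ∑ i ∈ Finset.range N, (m.h i * √(m.h i) * m.avg r i) * (√(m.h i) * m.avg e i) := by
        refine Finset.sum_le_sum fun i hi => ?_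
        have hi' := Finset.mem_range.1 hi
        refine (integral_cell_mul_le hr hW he hi' (hbound i hi')).trans_eq ?_
        linear_combination -(m.h i * m.avg r i * m.avg e i) * hsqrt hi
    _ ≤ √(∑ i ∈ Finset.range N, (m.h i * √(m.h i) * m.avg r i) ^ 2) *
          √(∑ i ∈ Finset.range N, (√(m.h i) * m.avg e i) ^ 2) :=
        Real.sum_mul_le_sqrt_mul_sqrt _ _ _
    _ = _ := by
        rw [← Real.sqrt_sq (lpNorm_nonneg (f := e)), ← m.sum_h_mul_avg_sq he]
        congr 2 <;> refine Finset.sum_congr rfl fun i hi => ?_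
        · linear_combination (m.h i ^ 2 * m.avg r i ^ 2) * hsqrt hi
        · rw [mul_pow, hsqrt hi]

end Mesh

lemma Mesh.IsFESol.bform_sub_eq_zero (huh : m.IsFESol a b c f uh) (ha : MemLp a ⊤ muOmega)
    (hb : MemLp b ⊤ muOmega) (hc : MemLp c ⊤ muOmega) (hu : IsH10Rep u u')
    (hsol : ∀ v v', IsH10Rep v v' → bform a b c u u' v v' = load f v) (hv : v ∈ m.feSpace) :
    bform a b c (fun x => u x - uh x) (fun x => u' x - deriv uh x) v (deriv v) = 0 := by
  have hv' := (isPL_of_mem_feSpace hv).isH10Rep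
  rw [bform_sub_left ha hb hc hu.memH1 (isPL_of_mem_feSpace huh.mem).isH10Rep.memH1 hv'.memH1,
    hsol v _ hv', huh.eqn v hv, sub_self]

theorem IsElliptic.error_le (hcoef : IsElliptic a a' b b' c a₀) (hf : MemLp f 2 muOmega)
    (hu : IsWeakSol a b c f u u') (huh : m.IsFESol a b c f uh) :
    a₀ * lpNorm (fun x => u' x - deriv uh x) 2 muOmega ≤ √(∑ i ∈ Finset.range N,
      m.h i ^ 3 * m.avg (residual a' b c f uh (deriv uh)) i ^ 2) := by
  obtain ⟨U, hU, -, hsol⟩ := hu.exists_isH10Rep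
  have ha := hcoef.memA.memLp
  have hb := hcoef.memB.memLp
  have hc := hcoef.memC
  have hPL := Mesh.isPL_of_mem_feSpace huh.mem
  have hE := hU.sub hPL.isH10Rep
  set E : ℝ → ℝ := fun x => U x - uh x
  set e : ℝ → ℝ := fun x => u' x - deriv uh x
  have hv := m.interpolant_mem_feSpace E
  set v := m.interpolant E
  have hvPL := Mesh.isPL_of_mem_feSpace hv
  have hnode : ∀ i ≤ N, v (m.x i) = E (m.x i) := fun i hi => Mesh.interpolant_node hE.zero hE.one hi
  have hW := hE.sub hvPL.isH10Rep
  have hgalerkin : bform a b c E e E e = ∫ x in Omega, residual a' b c f uh (deriv uh) x *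
      (E x - v x) := by
    rw [← hPL.load_sub_bform_eq hcoef.memA hb hc hf hW fun i hi => by rw [hnode i hi, sub_self],
      ← hsol _ _ hW, ← bform_sub_left ha hb hc hU.memH1 hPL.isH10Rep.memH1 hW.memH1,
      bform_sub_right ha hb hc hE.memH1 hE.memH1 hvPL.isH10Rep.memH1,
      huh.bform_sub_eq_zero ha hb hc hU hsol hv, sub_zero]
  have hsq := (hcoef.coercive hE).trans (hgalerkin.trans_le (Mesh.integral_mul_le
    (memLp_residual hcoef.memA.memLp_deriv hb hc hf hPL.isH10Rep.memH1) hW.memH1.memLp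
    hE.memLp_deriv fun i hi x hx =>
      hvPL.abs_sub_le_integral_cell hE.isPrimitive hnode hi (Set.Ioo_subset_Icc_self hx)))
  rcases (lpNorm_nonneg (f := e) (p := 2) (μ := muOmega)).eq_or_lt with he | he
  · rw [← he, mul_zero]
    positivity
  · rw [sq, ← mul_assoc] at hsq
    exact le_of_mul_le_mul_right hsq he

end ErrorEstimate

namespace Mesh

variable {N : ℕ} (m : Mesh N) {g r r' v w : ℝ → ℝ} {p : ℝ}

/-- `Σ_i h_i ⟨w⟩_i^p`, a Riemann sum for `∫_Ω |w|^p` that samples the cell averages of `w`;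
`α_h` is its cube for `p = 2/3`. -/
noncomputable def avgPowSum (p : ℝ) (w : ℝ → ℝ) : ℝ := ∑ i ∈ Finset.range N, m.h i * m.avg w i ^ p

lemma h_mul_avg_rpow_nonneg (p : ℝ) (w : ℝ → ℝ) :
    ∀ i ∈ Finset.range N, 0 ≤ m.h i * m.avg w i ^ p := fun i hi =>
  mul_nonneg (m.h_pos (Finset.mem_range.1 hi)).le (Real.rpow_nonneg (m.avg_nonneg w i) p)

lemma avgPowSum_nonneg (p : ℝ) (w : ℝ → ℝ) : 0 ≤ m.avgPowSum p w :=
  Finset.sum_nonneg (m.h_mul_avg_rpow_nonneg p w)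

lemma avgPowSum_congr (h : v =ᵐ[muOmega] w) : m.avgPowSum p v = m.avgPowSum p w :=
  Finset.sum_congr rfl fun _ hi => by rw [m.avg_congr h (Finset.mem_range.1 hi)]

lemma avgPowSum_add_le (hv : MemLp v 2 muOmega) (hw : MemLp w 2 muOmega) (hp₀ : 0 ≤ p)
    (hp : p ≤ 1) : m.avgPowSum p (v + w) ≤ m.avgPowSum p v + m.avgPowSum p w := by
  rw [avgPowSum, avgPowSum, avgPowSum, ← Finset.sum_add_distrib]
  refine Finset.sum_le_sum fun i hi => ?_
  have hi := Finset.mem_range.1 hi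
  rw [← mul_add]
  refine mul_le_mul_of_nonneg_left ?_ (m.h_pos hi).le
  exact (Real.rpow_le_rpow (m.avg_nonneg _ i) (m.avg_add_le hv hw hi) hp₀).trans
    (Real.rpow_add_le_add_rpow (m.avg_nonneg v i) (m.avg_nonneg w i) hp₀ hp)

lemma avgPowSum_le_add_avgPowSum_sub (hv : MemLp v 2 muOmega) (hw : MemLp w 2 muOmega)
    (hp₀ : 0 ≤ p) (hp : p ≤ 1) :
    m.avgPowSum p v ≤ m.avgPowSum p w + m.avgPowSum p (v - w) := by
  simpa only [add_sub_cancel] using m.avgPowSum_add_le hw (hv.sub hw) hp₀ hp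

lemma avgPowSum_le_lpNorm_rpow (hw : MemLp w 2 muOmega) (hp₀ : 0 ≤ p) (hp : p ≤ 2) :
    m.avgPowSum p w ≤ lpNorm w 2 muOmega ^ p := by
  have hJensen := m.sum_h_mul_rpow_le (d := fun i => m.avg w i ^ 2) (fun _ _ => sq_nonneg _)
    (div_nonneg hp₀ zero_le_two) (div_le_one_of_le₀ hp zero_le_two)
  simpa only [avgPowSum, m.sum_h_mul_avg_sq hw, sq_rpow_half (m.avg_nonneg w _),
    sq_rpow_half lpNorm_nonneg] using hJensen

lemma integral_rpow_le_avgPowSum (hw : MemLp w 2 muOmega) (hp₀ : 0 ≤ p) (hp : p ≤ 2) :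
    ∫ x in Omega, |w x| ^ p ≤ m.avgPowSum p w := by
  rw [← m.sum_integral (integrable_abs_rpow (q := 2) (by simpa using hw) hp₀ hp)]
  exact Finset.sum_le_sum fun i hi => m.integral_rpow_cell_le hw (Finset.mem_range.1 hi) hp₀ hp

lemma avgPowSum_le_of_oscillation_le {d : ℕ → ℝ} (hg : MemLp g 2 muOmega) (hp₀ : 0 ≤ p)
    (hp : p ≤ 1) (hd : ∀ i < N, ∀ x ∈ Set.Ioo (m.x i) (m.x (i + 1)),
      ∀ y ∈ Set.Ioo (m.x i) (m.x (i + 1)), |g y - g x| ≤ d i) :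
    m.avgPowSum p g ≤ (∫ x in Omega, |g x| ^ p) + ∑ i ∈ Finset.range N, m.h i * d i ^ p := by
  have hint : Integrable (fun x => |g x| ^ p) muOmega :=
    integrable_abs_rpow (q := 2) (by simpa using hg) hp₀ (hp.trans one_le_two)
  rw [← m.sum_integral hint, ← Finset.sum_add_distrib]
  refine Finset.sum_le_sum fun i hi => ?_
  have hi := Finset.mem_range.1 hi
  have hpoint : ∀ x ∈ Set.Ioo (m.x i) (m.x (i + 1)), m.avg g i ^ p ≤ |g x| ^ p + d i ^ p := by
    intro x hx
    have hd₀ : 0 ≤ d i := (abs_nonneg _).trans (hd i hi x hx x hx)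
    have havg : m.avg g i ≤ |g x| + d i := m.avg_le_of_abs_le hi fun y hy => by
      linarith [hd i hi x hx y hy, abs_sub_abs_le_abs_sub (g y) (g x)]
    exact (Real.rpow_le_rpow (m.avg_nonneg g i) havg hp₀).trans
      (Real.rpow_add_le_add_rpow (abs_nonneg _) hd₀ hp₀ hp)
  have hcell : IntegrableOn (fun x => |g x| ^ p) (Set.Ioo (m.x i) (m.x (i + 1))) :=
    hint.mono_measure (Measure.restrict_mono_set _ (m.Ioo_subset hi))
  calc m.h i * m.avg g i ^ p = ∫ _ in Set.Ioo (m.x i) (m.x (i + 1)), m.avg g i ^ p := by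
        rw [setIntegral_const, m.volume_real_cell hi, smul_eq_mul]
    _ ≤ ∫ x in Set.Ioo (m.x i) (m.x (i + 1)), (|g x| ^ p + d i ^ p) :=
        setIntegral_mono_on (integrable_const _) (hcell.add (integrable_const _))
          measurableSet_Ioo hpoint
    _ = (∫ x in Set.Ioo (m.x i) (m.x (i + 1)), |g x| ^ p) + m.h i * d i ^ p := by
        rw [integral_add hcell (integrable_const _), setIntegral_const, m.volume_real_cell hi,
          smul_eq_mul]

lemma avgPowSum_le_of_hasWeakDeriv {η : ℝ} (hr : MemLp r 2 muOmega) (hr' : HasWeakDeriv r r')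
    (hint : Integrable r' muOmega) (hη : ∀ i < N, m.h i ≤ η) (hp₀ : 0 ≤ p) (hp : p ≤ 1) :
    m.avgPowSum p r ≤ (∫ x in Omega, |r x| ^ p) + (η * ∫ x in Omega, |r' x|) ^ p := by
  obtain ⟨G, hG, hrG⟩ := hr'.exists_isPrimitive hint
  set d : ℕ → ℝ := fun i => ∫ x in Set.Ioo (m.x i) (m.x (i + 1)), |r' x|
  have hd₀ (i : ℕ) : 0 ≤ d i := integral_nonneg fun _ => abs_nonneg _
  have hosc : ∀ i < N, ∀ x ∈ Set.Ioo (m.x i) (m.x (i + 1)),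
      ∀ y ∈ Set.Ioo (m.x i) (m.x (i + 1)), |G y - G x| ≤ d i := by
    intro i hi x hx y hy
    exact ((hG.mono (m.uIcc_subset hi)).abs_sub_le_integral_abs (Set.Ioo_subset_Icc_self hy)
      (Set.Ioo_subset_Icc_self hx)).trans_eq (m.integral_cell hi _).symm
  have hG_le := m.avgPowSum_le_of_oscillation_le ((memLp_congr_ae hrG).1 hr) hp₀ hp hosc
  have hsum : ∑ i ∈ Finset.range N, m.h i * d i ≤ η * ∫ x in Omega, |r' x| := by
    rw [← m.sum_integral hint.abs, Finset.mul_sum]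
    exact Finset.sum_le_sum fun i hi =>
      mul_le_mul_of_nonneg_right (hη i (Finset.mem_range.1 hi)) (hd₀ i)
  have hintegral : ∫ x in Omega, |r x| ^ p = ∫ x in Omega, |G x| ^ p :=
    integral_congr_ae (hrG.fun_comp fun y => |y| ^ p)
  rw [m.avgPowSum_congr hrG, hintegral]
  refine hG_le.trans (add_le_add_right ?_ _)
  exact (m.sum_h_mul_rpow_le (fun i _ => hd₀ i) hp₀ hp).trans (Real.rpow_le_rpow
    (Finset.sum_nonneg fun i hi => mul_nonneg (m.h_pos (Finset.mem_range.1 hi)).le (hd₀ i))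
    hsum hp₀)

lemma avgPowSum_sub_integral_le (hr : MemLp r 2 muOmega) (hg : MemLp g 2 muOmega) (hp₀ : 0 ≤ p)
    (hp : p ≤ 1) : m.avgPowSum p r - ∫ x in Omega, |r x| ^ p ≤
      (m.avgPowSum p g - ∫ x in Omega, |g x| ^ p) + 2 * lpNorm (r - g) 2 muOmega ^ p := by
  have hint {w : ℝ → ℝ} (hw : MemLp w 2 muOmega) : Integrable (fun x => |w x| ^ p) muOmega :=
    integrable_abs_rpow (q := 2) (by simpa using hw) hp₀ (hp.trans one_le_two)
  have hrg := hr.sub hg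
  have hintegral : ∫ x in Omega, |g x| ^ p ≤
      (∫ x in Omega, |r x| ^ p) + ∫ x in Omega, |(r - g) x| ^ p := by
    refine (integral_mono (hint hg) ((hint hr).add (hint hrg)) fun x => ?_).trans_eq
      (integral_add (hint hr) (hint hrg))
    refine (Real.rpow_le_rpow (abs_nonneg _) ?_ hp₀).trans
      (Real.rpow_add_le_add_rpow (abs_nonneg _) (abs_nonneg _) hp₀ hp)
    simpa only [Pi.sub_apply, sub_sub_cancel] using abs_sub (r x) ((r - g) x)
  have hclose := m.avgPowSum_le_lpNorm_rpow hrg hp₀ (hp.trans one_le_two)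
  linarith [m.avgPowSum_le_add_avgPowSum_sub hr hg hp₀ hp,
    m.integral_rpow_le_avgPowSum hrg hp₀ (hp.trans one_le_two)]

end Mesh

section Refinement

variable {g r : ℝ → ℝ} {p δ : ℝ}

lemma exists_forall_mesh_avgPowSum_le_of_continuousOn (hg : ContinuousOn g (Set.Icc 0 1))
    (hp₀ : 0 < p) (hp : p ≤ 1) (hδ : 0 < δ) :
    ∃ η > 0, ∀ (N : ℕ) (m : Mesh N), (∀ i < N, m.h i ≤ η) →
      m.avgPowSum p g ≤ (∫ x in Omega, |g x| ^ p) + δ := by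
  obtain ⟨τ, hτ, hunif⟩ := Metric.uniformContinuousOn_iff_le.1
    (isCompact_Icc.uniformContinuousOn_of_continuous hg)
    (δ ^ p⁻¹) (Real.rpow_pos_of_pos hδ _)
  refine ⟨τ, hτ, fun N m hm => ?_⟩
  have hg₂ : MemLp g 2 muOmega := by
    obtain ⟨C, hC⟩ := isCompact_Icc.exists_bound_of_continuousOn hg
    have hmeas := (hg.aestronglyMeasurable measurableSet_Icc).mono_measure
      (Measure.restrict_mono_set volume Set.Ioo_subset_Icc_self)
    exact .of_bound hmeas C (ae_mem_Omega.mono fun x hx => hC x (Set.Ioo_subset_Icc_self hx))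
  have hosc := m.avgPowSum_le_of_oscillation_le hg₂ hp₀.le hp (d := fun _ => δ ^ p⁻¹) <| by
    intro i hi x hx y hy
    refine hunif y (m.Icc_subset hi (Set.Ioo_subset_Icc_self hy)) x
      (m.Icc_subset hi (Set.Ioo_subset_Icc_self hx)) ((Real.dist_le_of_mem_Icc
      (Set.Ioo_subset_Icc_self hy) (Set.Ioo_subset_Icc_self hx)).trans (hm i hi))
  rwa [← Finset.sum_mul, m.sum_h, one_mul, Real.rpow_inv_rpow hδ.le hp₀.ne'] at hosc

lemma exists_forall_mesh_avgPowSum_le (hr : MemLp r 2 muOmega) (hp₀ : 0 < p) (hp : p ≤ 1)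
    (hδ : 0 < δ) : ∃ η > 0, ∀ (N : ℕ) (m : Mesh N), (∀ i < N, m.h i ≤ η) →
      m.avgPowSum p r ≤ (∫ x in Omega, |r x| ^ p) + δ := by
  have hτ : 0 < (δ / 4) ^ p⁻¹ := by positivity
  obtain ⟨g, -, hrg, hg, hg₂⟩ := hr.exists_hasCompactSupport_eLpNorm_sub_le
    ENNReal.ofNat_ne_top (ENNReal.ofReal_pos.2 hτ).ne'
  have hclose : lpNorm (r - g) 2 muOmega ^ p ≤ δ / 4 := by
    rw [← Real.rpow_inv_rpow (by positivity : 0 ≤ δ / 4) hp₀.ne']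
    refine Real.rpow_le_rpow lpNorm_nonneg ?_ hp₀.le
    rw [← toReal_eLpNorm (hr.sub hg₂).1]
    exact ENNReal.toReal_le_of_le_ofReal hτ.le hrg
  obtain ⟨η, hη, hmesh⟩ := exists_forall_mesh_avgPowSum_le_of_continuousOn hg.continuousOn
    hp₀ hp (half_pos hδ)
  refine ⟨η, hη, fun N m hm => ?_⟩
  linarith [hmesh N m hm, m.avgPowSum_sub_integral_le hr hg₂ hp₀.le hp]

end Refinement

namespace Mesh

variable {N : ℕ} (m : Mesh N) {i : ℕ} {w : ℝ → ℝ}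

lemma alpha_eq_avgPowSum_pow (w : ℝ → ℝ) : m.alpha w = m.avgPowSum (2 / 3) w ^ 3 := rfl

lemma alpha_nonneg (w : ℝ → ℝ) : 0 ≤ m.alpha w := pow_nonneg (m.avgPowSum_nonneg _ w) 3

lemma alpha_rpow_one_third (w : ℝ → ℝ) : m.alpha w ^ (1 / 3 : ℝ) = m.avgPowSum (2 / 3) w := by
  rw [alpha_eq_avgPowSum_pow, one_div]
  exact Real.pow_rpow_inv_natCast (m.avgPowSum_nonneg _ w) three_ne_zero

lemma sqrt_alpha_rpow_two_thirds (w : ℝ → ℝ) :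
    √(m.alpha w) ^ (2 / 3 : ℝ) = m.avgPowSum (2 / 3) w := by
  rw [← alpha_rpow_one_third, Real.sqrt_eq_rpow, ← Real.rpow_mul (m.alpha_nonneg w)]
  norm_num

section Equidistribution

lemma avg_eq_zero_of_alpha_eq_zero (h : m.alpha w = 0) (hi : i < N) : m.avg w i = 0 := by
  have hsum : m.avgPowSum (2 / 3) w = 0 := eq_zero_of_pow_eq_zero h
  have hterm := (Finset.sum_eq_zero_iff_of_nonneg (m.h_mul_avg_rpow_nonneg _ w)).1 hsum i
    (Finset.mem_range.2 hi)
  exact ((Real.rpow_eq_zero_iff_of_nonneg (m.avg_nonneg w i)).1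
    ((mul_eq_zero.1 hterm).resolve_left (m.h_pos hi).ne')).1

lemma avg_sq_div_alpha_nonneg (w : ℝ → ℝ) (i : ℕ) : 0 ≤ m.avg w i ^ 2 / m.alpha w :=
  div_nonneg (sq_nonneg _) (m.alpha_nonneg w)

lemma one_le_rho (w : ℝ → ℝ) (i : ℕ) : 1 ≤ m.rho w i :=
  Real.one_le_rpow (le_add_of_nonneg_right (m.avg_sq_div_alpha_nonneg w i)) (by norm_num)

lemma avg_sq_le_alpha_mul_rho_pow (hi : i < N) : m.avg w i ^ 2 ≤ m.alpha w * m.rho w i ^ 3 := by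
  have hrho : m.rho w i ^ 3 = 1 + m.avg w i ^ 2 / m.alpha w := by
    rw [rho, one_div]
    exact Real.rpow_inv_natCast_pow (add_nonneg zero_le_one (m.avg_sq_div_alpha_nonneg w i))
      three_ne_zero
  rcases (m.alpha_nonneg w).eq_or_lt with h | h
  · rw [m.avg_eq_zero_of_alpha_eq_zero h.symm hi, ← h]
    norm_num
  · rw [hrho, mul_add, mul_div_cancel₀ _ h.ne', mul_one]
    exact le_add_of_nonneg_left h.le

lemma rho_le (w : ℝ → ℝ) (i : ℕ) :
    m.rho w i ≤ 1 + m.avg w i ^ (2 / 3 : ℝ) / m.avgPowSum (2 / 3) w := by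
  have havg : (m.avg w i ^ 2) ^ (1 / 3 : ℝ) = m.avg w i ^ (2 / 3 : ℝ) := by
    rw [← Real.rpow_natCast_mul (m.avg_nonneg w i)]
    norm_num
  refine (Real.rpow_add_le_add_rpow zero_le_one (m.avg_sq_div_alpha_nonneg w i) (by norm_num)
    (by norm_num)).trans_eq ?_
  rw [Real.one_rpow, Real.div_rpow (sq_nonneg _) (m.alpha_nonneg w), havg, alpha_rpow_one_third]

lemma sigma_le_two (w : ℝ → ℝ) : m.sigma w ≤ 2 :=
  calc m.sigma w
      ≤ ∑ i ∈ Finset.range N,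
          (1 + m.avg w i ^ (2 / 3 : ℝ) / m.avgPowSum (2 / 3) w) * m.h i :=
        Finset.sum_le_sum fun i hi =>
          mul_le_mul_of_nonneg_right (m.rho_le w i) (m.h_pos (Finset.mem_range.1 hi)).le
    _ = 1 + m.avgPowSum (2 / 3) w / m.avgPowSum (2 / 3) w := by
        simp only [add_mul, one_mul, Finset.sum_add_distrib, m.sum_h]
        nth_rewrite 2 [avgPowSum]
        rw [Finset.sum_div]
        exact congrArg _ (Finset.sum_congr rfl fun i _ => by ring)
    _ ≤ 2 := by linarith [div_self_le_one (m.avgPowSum (2 / 3) w)]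

variable {m}

lemma Equidistributes.rho_mul_h_le (hm : m.Equidistributes w) (hi : i < N) :
    m.rho w i * m.h i ≤ 2 / N := by
  rw [hm i hi]
  exact div_le_div_of_nonneg_right (m.sigma_le_two w) (Nat.cast_nonneg N)

lemma Equidistributes.h_le (hm : m.Equidistributes w) (hi : i < N) : m.h i ≤ 2 / N :=
  (le_mul_of_one_le_left (m.h_pos hi).le (m.one_le_rho w i)).trans (hm.rho_mul_h_le hi)

lemma Equidistributes.sum_h_pow_mul_avg_sq_le (hm : m.Equidistributes w) :
    ∑ i ∈ Finset.range N, m.h i ^ 3 * m.avg w i ^ 2 ≤ 8 * m.alpha w / N ^ 2 := by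
  have hN : (N : ℝ) ≠ 0 := Nat.cast_ne_zero.2 m.pos.ne'
  calc ∑ i ∈ Finset.range N, m.h i ^ 3 * m.avg w i ^ 2
      ≤ ∑ _i ∈ Finset.range N, m.alpha w * (2 / N) ^ 3 := by
        refine Finset.sum_le_sum fun i hi => ?_
        have hi := Finset.mem_range.1 hi
        have hh := (m.h_pos hi).le
        calc m.h i ^ 3 * m.avg w i ^ 2 ≤ m.h i ^ 3 * (m.alpha w * m.rho w i ^ 3) :=
              mul_le_mul_of_nonneg_left (m.avg_sq_le_alpha_mul_rho_pow hi) (pow_nonneg hh 3)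
          _ = m.alpha w * (m.rho w i * m.h i) ^ 3 := by ring
          _ ≤ m.alpha w * (2 / N) ^ 3 :=
              mul_le_mul_of_nonneg_left (pow_le_pow_left₀
                (mul_nonneg (zero_le_one.trans (m.one_le_rho w i)) hh) (hm.rho_mul_h_le hi) 3)
                (m.alpha_nonneg w)
    _ = 8 * m.alpha w / N ^ 2 := by
        rw [Finset.sum_const, Finset.card_range, nsmul_eq_mul]
        field_simp
        norm_num

end Equidistribution

end Mesh

section NormLp

variable {p : ℝ} {v : ℝ → ℝ}

lemma normLp_nonneg (p : ℝ) (v : ℝ → ℝ) : 0 ≤ normLp p v :=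
  Real.rpow_nonneg (integral_nonneg fun _ => Real.rpow_nonneg (abs_nonneg _) _) _

lemma normLp_rpow (hp : p ≠ 0) (v : ℝ → ℝ) : normLp p v ^ p = ∫ x in Omega, |v x| ^ p := by
  rw [normLp, one_div, Real.rpow_inv_rpow
    (integral_nonneg fun _ => Real.rpow_nonneg (abs_nonneg _) _) hp]

lemma normLp_one (v : ℝ → ℝ) : normLp 1 v = ∫ x in Omega, |v x| := by
  simpa only [Real.rpow_one] using normLp_rpow one_ne_zero v

lemma normLp_two (hv : AEStronglyMeasurable v muOmega) : normLp 2 v = lpNorm v 2 muOmega := by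
  refine (sq_eq_sq₀ (normLp_nonneg 2 v) lpNorm_nonneg).1 ?_
  rw [lpNorm_two_sq hv, ← Real.rpow_two, normLp_rpow two_ne_zero]
  simp only [Real.rpow_two, sq_abs, muOmega]

end NormLp

lemma rpow_neg_three_halves_mul_rpow {q x : ℝ} (hq : 0 < q) (hx : 0 ≤ x) :
    (q ^ (-(3 / 2) : ℝ) * x) ^ (2 / 3 : ℝ) = q⁻¹ * x ^ (2 / 3 : ℝ) := by
  rw [Real.mul_rpow (Real.rpow_nonneg hq.le _) hx, ← Real.rpow_mul hq.le, ← Real.rpow_neg_one]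
  norm_num

namespace Mesh

variable {N : ℕ} {m : Mesh N} {r v w : ℝ → ℝ} {δ κ : ℝ}

lemma avgPowSum_le_mul_avgPowSum (hv : MemLp v 2 muOmega) (hκ : 0 ≤ κ)
    (h : lpNorm v 2 muOmega ≤ κ * √(m.alpha w)) :
    m.avgPowSum (2 / 3) v ≤ κ ^ (2 / 3 : ℝ) * m.avgPowSum (2 / 3) w := by
  rw [← m.sqrt_alpha_rpow_two_thirds w, ← Real.mul_rpow hκ (Real.sqrt_nonneg _)]
  exact (m.avgPowSum_le_lpNorm_rpow hv (by norm_num) (by norm_num)).trans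
    (Real.rpow_le_rpow lpNorm_nonneg h (by norm_num))

theorem mul_normLp_le_sqrt_alpha (hr : MemLp r 2 muOmega) (hw : MemLp w 2 muOmega)
    (hκ : 0 ≤ κ) (h : lpNorm (r - w) 2 muOmega ≤ κ * √(m.alpha w)) :
    (1 + κ ^ (2 / 3 : ℝ)) ^ (-(3 / 2) : ℝ) * normLp (2 / 3) r ≤ √(m.alpha w) := by
  have hq : 0 < 1 + κ ^ (2 / 3 : ℝ) := by positivity
  have hR := normLp_nonneg (2 / 3) r
  refine (Real.rpow_le_rpow_iff (by positivity) (Real.sqrt_nonneg _)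
    (by norm_num : (0 : ℝ) < 2 / 3)).1 ?_
  rw [rpow_neg_three_halves_mul_rpow hq hR, inv_mul_le_iff₀ hq, normLp_rpow (by norm_num),
    m.sqrt_alpha_rpow_two_thirds]
  linarith [m.integral_rpow_le_avgPowSum hr (p := 2 / 3) (by norm_num) (by norm_num),
    m.avgPowSum_le_add_avgPowSum_sub hr hw (p := 2 / 3) (by norm_num) (by norm_num),
    m.avgPowSum_le_mul_avgPowSum (hr.sub hw) hκ h]

theorem sqrt_alpha_le_mul (hr : MemLp r 2 muOmega) (hw : MemLp w 2 muOmega) (hκ : 0 ≤ κ)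
    (hκ₁ : κ < 1) (h : lpNorm (r - w) 2 muOmega ≤ κ * √(m.alpha w))
    (hδ : m.avgPowSum (2 / 3) r ≤ (∫ x in Omega, |r x| ^ (2 / 3 : ℝ)) + δ) :
    √(m.alpha w) ≤ (1 - κ ^ (2 / 3 : ℝ)) ^ (-(3 / 2) : ℝ) *
      (normLp (2 / 3) r ^ (2 / 3 : ℝ) + δ) ^ (3 / 2 : ℝ) := by
  have hq : 0 < 1 - κ ^ (2 / 3 : ℝ) := sub_pos.2 (Real.rpow_lt_one hκ hκ₁ (by norm_num))
  rw [← normLp_rpow (by norm_num)] at hδ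
  have hS := (m.avgPowSum_nonneg (2 / 3) r).trans hδ
  refine (Real.rpow_le_rpow_iff (Real.sqrt_nonneg _) (by positivity)
    (by norm_num : (0 : ℝ) < 2 / 3)).1 ?_
  rw [rpow_neg_three_halves_mul_rpow hq (by positivity), ← Real.rpow_mul hS, le_inv_mul_iff₀ hq,
    m.sqrt_alpha_rpow_two_thirds, show (3 / 2 * (2 / 3) : ℝ) = 1 by norm_num, Real.rpow_one]
  rw [lpNorm_sub_comm] at h
  linarith [m.avgPowSum_le_add_avgPowSum_sub hw hr (p := 2 / 3) (by norm_num) (by norm_num),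
    m.avgPowSum_le_mul_avgPowSum (hw.sub hr) hκ h]

end Mesh

lemma eventually_bounds_mem_Ioo {R ε : ℝ} (hR : 0 ≤ R) (hε : 0 < ε) : ∀ᶠ τ : ℝ in 𝓝 0,
    R - ε < (1 + τ ^ (2 / 3 : ℝ)) ^ (-(3 / 2) : ℝ) * R ∧
    (1 - τ ^ (2 / 3 : ℝ)) ^ (-(3 / 2) : ℝ) * (R ^ (2 / 3 : ℝ) + τ) ^ (3 / 2 : ℝ) < R + ε := by
  have hpow : ContinuousAt (fun τ : ℝ => τ ^ (2 / 3 : ℝ)) 0 :=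
    Real.continuousAt_rpow_const _ _ (.inr (by norm_num))
  have hlow : ContinuousAt (fun τ : ℝ => (1 + τ ^ (2 / 3 : ℝ)) ^ (-(3 / 2) : ℝ) * R) 0 :=
    ((continuousAt_const.add hpow).rpow_const (.inl (by norm_num))).mul continuousAt_const
  have hupp : ContinuousAt (fun τ : ℝ =>
      (1 - τ ^ (2 / 3 : ℝ)) ^ (-(3 / 2) : ℝ) * (R ^ (2 / 3 : ℝ) + τ) ^ (3 / 2 : ℝ)) 0 :=
    ((continuousAt_const.sub hpow).rpow_const (.inl (by norm_num))).mul
      ((continuousAt_const.add continuousAt_id).rpow_const (.inr (by norm_num)))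
  have hzero : (0 : ℝ) ^ (2 / 3 : ℝ) = 0 := Real.zero_rpow (by norm_num)
  have hR' : (R ^ (2 / 3 : ℝ)) ^ (3 / 2 : ℝ) = R := by
    rw [← Real.rpow_mul hR]
    norm_num
  refine (hlow.eventually_const_lt ?_).and (hupp.eventually_lt_const ?_)
  · beta_reduce
    rw [hzero, add_zero, Real.one_rpow, one_mul]
    exact sub_lt_self R hε
  · beta_reduce
    rw [hzero, sub_zero, add_zero, Real.one_rpow, one_mul, hR']
    exact lt_add_of_pos_right R hε

theorem exists_forall_mesh_abs_sqrt_alpha_sub_lt {r : ℝ → ℝ} {ε : ℝ} (hr : MemLp r 2 muOmega)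
    (hε : 0 < ε) : ∃ κ > 0, ∃ η > 0, ∀ (N : ℕ) (m : Mesh N) (w : ℝ → ℝ), MemLp w 2 muOmega →
      (∀ i < N, m.h i ≤ η) → lpNorm (r - w) 2 muOmega ≤ κ * √(m.alpha w) →
      |√(m.alpha w) - normLp (2 / 3) r| < ε := by
  obtain ⟨τ, ⟨hlow, hupp⟩, hτ₀, hτ₁⟩ : ∃ τ : ℝ, _ ∧ τ ∈ Set.Ioo 0 1 :=
    (((eventually_bounds_mem_Ioo (normLp_nonneg (2 / 3) r) hε).filter_mono
      nhdsWithin_le_nhds).and (Ioo_mem_nhdsGT zero_lt_one)).exists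
  obtain ⟨η, hη, hmesh⟩ := exists_forall_mesh_avgPowSum_le (p := 2 / 3) hr (by norm_num)
    (by norm_num) hτ₀
  refine ⟨τ, hτ₀, η, hη, fun N m w hw hm h => abs_sub_lt_iff.2 ⟨?_, ?_⟩⟩
  · linarith [m.sqrt_alpha_le_mul hr hw hτ₀.le hτ₁ h (hmesh N m hm)]
  · linarith [m.mul_normLp_le_sqrt_alpha hr hw hτ₀.le h]

lemma lpNorm_mul_le {α : Type*} [MeasurableSpace α] {μ : Measure α} {f g : α → ℝ} {p : ENNReal}
    (hf : MemLp f ⊤ μ) (hg : MemLp g p μ) :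
    lpNorm (fun x => f x * g x) p μ ≤ lpNorm f ⊤ μ * lpNorm g p μ := by
  rw [← toReal_eLpNorm (hf.1.fun_mul hg.1), ← toReal_eLpNorm hf.1, ← toReal_eLpNorm hg.1,
    ← ENNReal.toReal_mul]
  refine ENNReal.toReal_mono (ENNReal.mul_ne_top hf.eLpNorm_ne_top hg.eLpNorm_ne_top) ?_
  simpa using eLpNorm_le_eLpNorm_top_mul_eLpNorm p f hg.1 (· * ·) 1
    (.of_forall fun x => by simp [nnnorm_mul])

lemma lpNorm_residual_sub_le {a' b c f u u' v v' : ℝ → ℝ} (ha' : MemLp a' ⊤ muOmega)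
    (hb : MemLp b ⊤ muOmega) (hc : MemLp c ⊤ muOmega)
    (h : IsH10Rep (fun x => u x - v x) (fun x => u' x - v' x)) :
    lpNorm (residual a' b c f u u' - residual a' b c f v v') 2 muOmega ≤
      (lpNorm (a' - b) ⊤ muOmega + lpNorm c ⊤ muOmega) *
        lpNorm (fun x => u' x - v' x) 2 muOmega := by
  have hab := ha'.sub hb
  have hsplit : residual a' b c f u u' - residual a' b c f v v' =
      (fun x => (a' - b) x * (u' x - v' x)) - fun x => c x * (u x - v x) := by
    ext x
    simp only [residual, Pi.sub_apply]
    ring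
  calc lpNorm (residual a' b c f u u' - residual a' b c f v v') 2 muOmega
      ≤ lpNorm (fun x => (a' - b) x * (u' x - v' x)) 2 muOmega +
          lpNorm (fun x => c x * (u x - v x)) 2 muOmega := by
        rw [hsplit]
        exact lpNorm_sub_le (h.memLp_deriv.mul' hab) one_le_two
    _ ≤ lpNorm (a' - b) ⊤ muOmega * lpNorm (fun x => u' x - v' x) 2 muOmega +
          lpNorm c ⊤ muOmega * lpNorm (fun x => u' x - v' x) 2 muOmega :=
        add_le_add (lpNorm_mul_le hab h.memLp_deriv)
          ((lpNorm_mul_le hc h.memH1.memLp).trans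
            (mul_le_mul_of_nonneg_left h.lpNorm_le lpNorm_nonneg))
    _ = _ := (add_mul _ _ _).symm

/-- The constant `K` of the bound `‖r - r_h‖_{L²} ≤ K √α_h / N` between the residuals of the weak
solution and of the finite element solution on an equidistributing mesh. -/
noncomputable def residualConst (a' b c : ℝ → ℝ) (a₀ : ℝ) : ℝ :=
  (lpNorm (a' - b) ⊤ muOmega + lpNorm c ⊤ muOmega) * (3 / a₀)

lemma IsWeakSol.memLp_residual {a a' b b' c f u u' : ℝ → ℝ} {a₀ : ℝ}
    (hcoef : IsElliptic a a' b b' c a₀) (hf : MemLp f 2 muOmega)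
    (hu : IsWeakSol a b c f u u') : MemLp (residual a' b c f u u') 2 muOmega :=
  EquiFEM.memLp_residual hcoef.memA.memLp_deriv hcoef.memB.memLp hcoef.memC hf hu.mem.memH1

namespace IsEquiFESol

variable {N : ℕ} {m : Mesh N} {a a' b b' c f u u' uh : ℝ → ℝ} {a₀ : ℝ}

lemma memLp_residual (hcoef : IsElliptic a a' b b' c a₀) (hf : MemLp f 2 muOmega)
    (huh : IsEquiFESol m a a' b c f uh) : MemLp (residual a' b c f uh (deriv uh)) 2 muOmega :=
  EquiFEM.memLp_residual hcoef.memA.memLp_deriv hcoef.memB.memLp hcoef.memC hf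
    (Mesh.isPL_of_mem_feSpace huh.sol.mem).isH10Rep.memH1

theorem lpNorm_deriv_sub_le (hcoef : IsElliptic a a' b b' c a₀) (hf : MemLp f 2 muOmega)
    (hu : IsWeakSol a b c f u u') (huh : IsEquiFESol m a a' b c f uh) :
    lpNorm (fun x => u' x - deriv uh x) 2 muOmega ≤
      3 / a₀ * √(m.alpha (residual a' b c f uh (deriv uh))) / N := by
  set α := m.alpha (residual a' b c f uh (deriv uh))
  have hα : 0 ≤ α := m.alpha_nonneg _
  rw [mul_div_assoc, div_mul_eq_mul_div, le_div_iff₀ hcoef.pos, mul_comm]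
  refine (hcoef.error_le hf hu huh.sol).trans
    ((Real.sqrt_le_sqrt huh.equi.sum_h_pow_mul_avg_sq_le).trans ?_)
  refine Real.sqrt_le_iff.2 ⟨by positivity, ?_⟩
  rw [mul_pow, div_pow, Real.sq_sqrt hα, ← mul_div_assoc]
  exact div_le_div_of_nonneg_right (by linarith) (by positivity)

theorem lpNorm_residual_sub_le (hcoef : IsElliptic a a' b b' c a₀) (hf : MemLp f 2 muOmega)
    (hu : IsWeakSol a b c f u u') (huh : IsEquiFESol m a a' b c f uh) :
    lpNorm (residual a' b c f u u' - residual a' b c f uh (deriv uh)) 2 muOmega ≤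
      residualConst a' b c a₀ / N * √(m.alpha (residual a' b c f uh (deriv uh))) := by
  obtain ⟨U, hU, huU, -⟩ := hu.exists_isH10Rep
  have hPL := Mesh.isPL_of_mem_feSpace huh.sol.mem
  have ha' := hcoef.memA.memLp_deriv
  have hb := hcoef.memB.memLp
  have hcongr : residual a' b c f u u' - residual a' b c f uh (deriv uh) =ᵐ[muOmega]
      residual a' b c f U u' - residual a' b c f uh (deriv uh) :=
    (residual_congr_ae huU).sub .rfl
  have hmeas := ((EquiFEM.memLp_residual ha' hb hcoef.memC hf hU.memH1).sub
    (huh.memLp_residual hcoef hf)).1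
  calc lpNorm (residual a' b c f u u' - residual a' b c f uh (deriv uh)) 2 muOmega
      = lpNorm (residual a' b c f U u' - residual a' b c f uh (deriv uh)) 2 muOmega := by
        rw [← toReal_eLpNorm hmeas, ← toReal_eLpNorm (hmeas.congr hcongr.symm),
          eLpNorm_congr_ae hcongr]
    _ ≤ (lpNorm (a' - b) ⊤ muOmega + lpNorm c ⊤ muOmega) *
          lpNorm (fun x => u' x - deriv uh x) 2 muOmega :=
        EquiFEM.lpNorm_residual_sub_le ha' hb hcoef.memC (hU.sub hPL.isH10Rep)
    _ ≤ (lpNorm (a' - b) ⊤ muOmega + lpNorm c ⊤ muOmega) *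
          (3 / a₀ * √(m.alpha (residual a' b c f uh (deriv uh))) / N) :=
        mul_le_mul_of_nonneg_left (huh.lpNorm_deriv_sub_le hcoef hf hu)
          (add_nonneg lpNorm_nonneg lpNorm_nonneg)
    _ = _ := by
        rw [residualConst]
        ring

theorem normLp_deriv_sub_le (hcoef : IsElliptic a a' b b' c a₀) (hf : MemLp f 2 muOmega)
    (hu : IsWeakSol a b c f u u') (huh : IsEquiFESol m a a' b c f uh) :
    normLp 2 (fun x => u' x - deriv uh x) ≤
      3 / a₀ * √(m.alpha (residual a' b c f uh (deriv uh))) / N := by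
  have hderiv := hu.mem.memH1.memLp_deriv.sub
    (Mesh.isPL_of_mem_feSpace huh.sol.mem).isH10Rep.memLp_deriv
  exact (normLp_two hderiv.1).trans_le (huh.lpNorm_deriv_sub_le hcoef hf hu)

theorem mul_normLp_residual_le_sqrt_alpha (hcoef : IsElliptic a a' b b' c a₀)
    (hf : MemLp f 2 muOmega) (hu : IsWeakSol a b c f u u') {c₀ : ℝ} (hc₀ : 0 ≤ c₀)
    (hK : residualConst a' b c a₀ ≤ c₀) (huh : IsEquiFESol m a a' b c f uh) :
    (1 + (c₀ / N) ^ (2 / 3 : ℝ)) ^ (-(3 / 2) : ℝ) * normLp (2 / 3) (residual a' b c f u u') ≤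
      √(m.alpha (residual a' b c f uh (deriv uh))) :=
  Mesh.mul_normLp_le_sqrt_alpha (hu.memLp_residual hcoef hf) (huh.memLp_residual hcoef hf)
    (by positivity) ((huh.lpNorm_residual_sub_le hcoef hf hu).trans (by gcongr))

theorem sqrt_alpha_le_mul (hcoef : IsElliptic a a' b b' c a₀) (hf : MemLp f 2 muOmega)
    (hu : IsWeakSol a b c f u u') {r' : ℝ → ℝ} (hr' : HasWeakDeriv (residual a' b c f u u') r')
    (hint : Integrable r' muOmega) {c₀ : ℝ} (hc₀ : 2 ≤ c₀) (hK : residualConst a' b c a₀ ≤ c₀)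
    (hN : c₀ < N) (huh : IsEquiFESol m a a' b c f uh) :
    √(m.alpha (residual a' b c f uh (deriv uh))) ≤
      (1 - (c₀ / N) ^ (2 / 3 : ℝ)) ^ (-(3 / 2) : ℝ) *
        (normLp (2 / 3) (residual a' b c f u u') ^ (2 / 3 : ℝ) +
          (c₀ * normLp 1 r' / N) ^ (2 / 3 : ℝ)) ^ (3 / 2 : ℝ) := by
  have hr := hu.memLp_residual hcoef hf
  have hmesh : ∀ i < N, m.h i ≤ c₀ / N := fun i hi =>
    (huh.equi.h_le hi).trans (by gcongr)
  have hδ := m.avgPowSum_le_of_hasWeakDeriv hr hr' hint hmesh (p := 2 / 3) (by norm_num)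
    (by norm_num)
  rw [← normLp_one, div_mul_eq_mul_div] at hδ
  exact m.sqrt_alpha_le_mul hr (huh.memLp_residual hcoef hf) (by positivity)
    ((div_lt_one (by linarith)).2 hN)
    ((huh.lpNorm_residual_sub_le hcoef hf hu).trans (by gcongr)) hδ

end IsEquiFESol

theorem IsWeakSol.exists_forall_abs_sqrt_alpha_sub_lt {a a' b b' c f u u' : ℝ → ℝ} {a₀ ε : ℝ}
    (hcoef : IsElliptic a a' b b' c a₀) (hf : MemLp f 2 muOmega)
    (hu : IsWeakSol a b c f u u') (hε : 0 < ε) :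
    ∃ N₀ : ℕ, ∀ N ≥ N₀, ∀ (m : Mesh N) (uh : ℝ → ℝ), IsEquiFESol m a a' b c f uh →
      |√(m.alpha (residual a' b c f uh (deriv uh))) -
        normLp (2 / 3) (residual a' b c f u u')| < ε := by
  obtain ⟨κ, hκ, η, hη, hconv⟩ :=
    exists_forall_mesh_abs_sqrt_alpha_sub_lt (hu.memLp_residual hcoef hf) hε
  have hsmall : ∀ᶠ N : ℕ in atTop, residualConst a' b c a₀ / N < κ ∧ (2 : ℝ) / N < η :=
    ((tendsto_const_div_atTop_nhds_zero_nat _).eventually_lt_const hκ).and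
      ((tendsto_const_div_atTop_nhds_zero_nat _).eventually_lt_const hη)
  obtain ⟨N₀, hN₀⟩ := eventually_atTop.1 hsmall
  refine ⟨N₀, fun N hN m uh huh => ?_⟩
  obtain ⟨hκN, hηN⟩ := hN₀ N hN
  exact hconv N m _ (huh.memLp_residual hcoef hf)
    (fun i hi => (huh.equi.h_le hi).trans hηN.le)
    ((huh.lpNorm_residual_sub_le hcoef hf hu).trans
      (mul_le_mul_of_nonneg_right hκN.le (Real.sqrt_nonneg _)))

end EquiFEM

theorem theorem2p1 (a a' b b' c : ℝ → ℝ) (a₀ : ℝ)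
    (hcoef : EquiFEM.IsElliptic a a' b b' c a₀) :
    ∃ C > (0 : ℝ), ∃ c₀ > (0 : ℝ),
      ∀ f : ℝ → ℝ, MemLp f 2 EquiFEM.muOmega →
      ∀ u u' : ℝ → ℝ, EquiFEM.IsWeakSol a b c f u u' →
        (∀ (N : ℕ) (m : EquiFEM.Mesh N) (uh : ℝ → ℝ), EquiFEM.IsEquiFESol m a a' b c f uh →
          EquiFEM.normLp 2 (fun x => u' x - deriv uh x) ≤
            C * Real.sqrt (m.alpha (EquiFEM.residual a' b c f uh (deriv uh))) / N) ∧
        (∀ ε > (0 : ℝ), ∃ N₀ : ℕ, ∀ N ≥ N₀, ∀ (m : EquiFEM.Mesh N) (uh : ℝ → ℝ),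
          EquiFEM.IsEquiFESol m a a' b c f uh →
          |Real.sqrt (m.alpha (EquiFEM.residual a' b c f uh (deriv uh))) -
            EquiFEM.normLp (2 / 3) (EquiFEM.residual a' b c f u u')| < ε) ∧
        (∀ r' : ℝ → ℝ, EquiFEM.HasWeakDeriv (EquiFEM.residual a' b c f u u') r' →
          MemLp r' 1 EquiFEM.muOmega →
          ∀ (N : ℕ) (m : EquiFEM.Mesh N) (uh : ℝ → ℝ), c₀ < N →
          EquiFEM.IsEquiFESol m a a' b c f uh →
          (1 + (c₀ / N) ^ (2 / 3 : ℝ)) ^ (-(3 / 2) : ℝ) *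
              EquiFEM.normLp (2 / 3) (EquiFEM.residual a' b c f u u') ≤
            Real.sqrt (m.alpha (EquiFEM.residual a' b c f uh (deriv uh))) ∧
          Real.sqrt (m.alpha (EquiFEM.residual a' b c f uh (deriv uh))) ≤
            (1 - (c₀ / N) ^ (2 / 3 : ℝ)) ^ (-(3 / 2) : ℝ) *
              (EquiFEM.normLp (2 / 3) (EquiFEM.residual a' b c f u u') ^ (2 / 3 : ℝ) +
                (c₀ * EquiFEM.normLp 1 r' / N) ^ (2 / 3 : ℝ)) ^ (3 / 2 : ℝ)) := by
  refine ⟨3 / a₀, div_pos three_pos hcoef.pos, max 2 (EquiFEM.residualConst a' b c a₀),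
    two_pos.trans_le (le_max_left _ _), fun f hf u u' hu => ⟨?_, ?_, ?_⟩⟩
  · exact fun N m uh huh => huh.normLp_deriv_sub_le hcoef hf hu
  · exact fun ε hε => hu.exists_forall_abs_sqrt_alpha_sub_lt hcoef hf hε
  · exact fun r' hr' hint N m uh hN huh =>
      ⟨huh.mul_normLp_residual_le_sqrt_alpha hcoef hf hu (zero_le_two.trans (le_max_left _ _))
        (le_max_right _ _),
      huh.sqrt_alpha_le_mul hcoef hf hu hr' (memLp_one_iff_integrable.1 hint) (le_max_left _ _)
        (le_max_right _ _) hN⟩
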